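/- Let $n\ge 1$ ($n=1$: scalar displacement, $n=3$: displacement vector), $\rho>0$. For $\mathbb{C}^n$-valued fields $u$ on $\mathbb{R}^3$ (real fields are a special case) write $\nabla u=(\partial_j u_i)_{i\le n,\,j\le 3}$ and $\mathrm{D}=\partial_t$. *Kernel in time.* Let $g:\mathbb{R}\to\mathbb{R}$ be locally integrable on $[0,\infty)$ and causally positive definite, i.e. $\int_{\mathbb{R}}\int_0^\infty g(y)\varphi(x-y)\varphi(x)\,dy\,dx\ge 0$ for every real $\varphi\in C_c^\infty(\mathbb{R})$. Let $m$ be its spectral measure: the positive tempered Radon measure on $\mathbb{R}$ with $g(|t|)=\int_{\mathbb{R}}e^{ist}\,m(ds)$ in the sense of distributions on $\mathbb{R}$ (that is, $m=\pi^{-1}\,\mathrm{Re}\,\hat g$ for the causal kernel $g$; $m$ may have infinite mass). *Stiffness operator.* Let $\hat H(k)$ be a real matrix acting on $\mathbb{C}^{n\times 3}$, measurable in $k\in\mathbb{R}^3$, symmetric and positive definite for each $k\ne0$. Let $H\ast_x$ and $H_{-1}\ast_x$ denote the pseudo-differential operators in $L^2(\mathbb{R}^3)$ with symbols $\hat H(k)$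 and $\hat H(k)^{-1}$, with respect to $\hat f(k)=\int e^{-ik\cdot x}f(x)\,dx$. *Solutions.* Let $u\in C^1([0,\infty);L^2(\mathbb{R}^3)^n)$ be such that $\nabla \mathrm{D}u(t)$ (weak gradient) and $\psi(t):=H\ast_x\nabla \mathrm{D}u(t)$ belong to $L^2$ and depend continuously on $t\ge0$ in $L^2$, and such that $$\rho\,\mathrm{D}^2u=\operatorname{div}\sigma,\qquad \sigma(t)=\int_0^t g(t-\tau)\,\psi(\tau)\,d\tau ,$$ holds for $t>0$ weakly in space: for all Schwartz functions $\varphi$ and all $i$, $\rho\,\frac{d}{dt}\int \mathrm{D}u_i\,\varphi\,dx=-\sum_j\int\sigma_{ij}\,\partial_j\varphi\,dx$. Put $\mathbf{y}(t,x;s)=\int_0^t e^{is(t-\tau)}\psi(\tau,x)\,d\tau$ and define the stored energy $$U(t)=\frac12\int_{\mathbb{R}}\int_{\mathbb{R}^3}\mathbf{y}(t,x;s)^\dagger\,\bigl(H_{-1}\ast_x\mathbf{y}(t,\cdot\,;s)\bigr)(x)\,dx\,m(ds).$$ Then for all $t\ge 0$: $\mathbf{y}(t,\cdot\,;s)$ lies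 in the $L^2$-domain of $H_{-1}\ast_x$ for every $s$ and the integral over $s$ defining $U(t)$ converges absolutely; energy is conserved, $$\frac{d}{dt}\left[\int_{\mathbb{R}^3}\frac{\rho\,|\mathrm{D}u|^2}{2}\,dx+U\right]=0$$ (one-sided derivative at $t=0$); and $U(t)$ is real and $U(t)\ge0$. -/

import Mathlib

open MeasureTheory Set Filter Topology FourierTransform SchwartzMap LineDeriv
open scoped ContDiff

noncomputable section

namespace NonlocalVisco

/-- Physical space `ℝ³`; also the space of wave vectors. -/
abbrev Space : Type := EuclideanSpace ℝ (Fin 3)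

/-- Complex scalar fields in `L²(ℝ³)`. -/
abbrev L2 : Type := Lp ℂ 2 (volume : Measure Space)

/-- Index set of the components `∂_j u_i` of a gradient field when `u` has `n` components
(`n = 1`: scalar displacement, `n = 3`: displacement vector). -/
abbrev GradIdx (n : ℕ) : Type := Fin n × Fin 3

/-- `∂f/∂x_j` of a tempered distribution. -/
def pderiv (j : Fin 3) (f : 𝓢'(Space, ℂ)) : 𝓢'(Space, ℂ) :=
  ∂_{(EuclideanSpace.single j (1 : ℝ) : Space)} f

/-- A real function `g` on the half line is causally positive definite: it is locally integrable on
`[0, ∞)` and `∫ (∫_0^∞ g(y) φ(x - y) dy) φ(x) dx ≥ 0` for all real test functions `φ`. -/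
def IsCausallyPositiveDefinite (g : ℝ → ℝ) : Prop :=
  LocallyIntegrableOn g (Ici 0) ∧
    ∀ φ : ℝ → ℝ, ContDiff ℝ ∞ φ → HasCompactSupport φ →
      0 ≤ ∫ x, ∫ y in Ioi (0 : ℝ), g y * φ (x - y) * φ x

/-- `m` is the spectral measure of `g`: a tempered positive measure on `ℝ` with
`g(|t|) = ∫ e^{ist} m(ds)` in the sense of distributions on `ℝ`. For a causal kernel `g` this says
`m = π⁻¹ Re ĝ`. The identity is tested against compactly supported `φ` because `g` is only locally
integrable; `m` may have infinite mass, and then `g` is unbounded at `0`. -/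
def IsSpectralMeasure (g : ℝ → ℝ) (m : Measure ℝ) : Prop :=
  m.HasTemperateGrowth ∧
    ∀ φ : 𝓢(ℝ, ℂ), HasCompactSupport φ →
      ∫ t : ℝ, (g |t| : ℂ) * φ t = ∫ s, (∫ t : ℝ, Complex.exp (Complex.I * s * t) * φ t) ∂m

section Multiplier

variable {ι : Type} [Fintype ι]

/-- The Fourier side `Â(k) f̂(k)`, `k = 2πξ`, of the operator with matrix symbol `A`.
Mathlib's transform is `𝓕 f ξ = ∫ e^{-2πi x·ξ} f(x) dx = f̂(2πξ)`. -/
def symbolMul (A : Space → Matrix ι ι ℝ) (f : ι → L2) (a : ι) (ξ : Space) : ℂ :=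
  ∑ b, (A ((2 * Real.pi) • ξ) a b : ℂ) * (𝓕 (f b) : L2) ξ

/-- `f` is in the `L²` domain of the operator with matrix symbol `A`. -/
def InDomain (A : Space → Matrix ι ι ℝ) (f : ι → L2) : Prop :=
  ∀ a, MemLp (symbolMul A f a) 2 volume

open Classical in
/-- The pseudo-differential operator with matrix symbol `A`, that is, convolution `K ∗ₓ f` with the
kernel `K` whose Fourier transform is `A` (value `0` outside of the domain `InDomain A`). -/
def symbolOp (A : Space → Matrix ι ι ℝ) (f : ι → L2) : ι → L2 := fun a =>
  if h : MemLp (symbolMul A f a) 2 volume then 𝓕⁻ (h.toLp (symbolMul A f a)) else 0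

end Multiplier

variable {n : ℕ}

/-- The stress `σ = g ∗ₜ ψ`, for a field `ψ`. -/
def stress (g : ℝ → ℝ) (ψ : ℝ → GradIdx n → L2) (t : ℝ) (a : GradIdx n) : L2 :=
  ∫ τ in (0 : ℝ)..t, (g (t - τ) : ℂ) • ψ τ a

/-- The auxiliary field `y(t, · ; s) = ∫_0^t e^{is(t-τ)} ψ(τ) dτ`. -/
def auxField (ψ : ℝ → GradIdx n → L2) (t s : ℝ) (a : GradIdx n) : L2 :=
  ∫ τ in (0 : ℝ)..t, Complex.exp (Complex.I * s * (t - τ)) • ψ τ a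

/-- `∫ y(t,x;s)† (H₋₁ ∗ₓ y(t,·;s))(x) dx`, where `H₋₁` is the kernel with Fourier transform
`Ĥ(k)⁻¹`. -/
def storedDensity (H : Space → Matrix (GradIdx n) (GradIdx n) ℝ) (ψ : ℝ → GradIdx n → L2)
    (t s : ℝ) : ℂ :=
  ∫ x, ∑ a, (starRingEnd ℂ) (auxField ψ t s a x) *
    symbolOp (fun k => (H k)⁻¹) (auxField ψ t s) a x

/-- The stored energy `U(t) = ½ ∫ ∫ ∫ y(t,x;s)† H₋₁(x - x') y(t,x';s) dx' dx m(ds)`. -/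
def storedEnergy (m : Measure ℝ) (H : Space → Matrix (GradIdx n) (GradIdx n) ℝ)
    (ψ : ℝ → GradIdx n → L2) (t : ℝ) : ℂ :=
  (1 / 2) * ∫ s, storedDensity H ψ t s ∂m

/-- The kinetic energy `∫ ρ |v|² / 2 dx`. -/
def kineticEnergy (ρ : ℝ) (v : Fin n → L2) : ℝ :=
  ∫ x, ρ * (∑ i, ‖v i x‖ ^ 2) / 2

/-- `u` is a (strong in time, weak in space) solution on `[0, ∞)` of
`ρ D²u = div σ`, `σ = g ∗ₜ H ∗ₓ ∇Du`, with velocity `v = Du` and velocity gradient `G = ∇Du`: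
`u` is a continuously differentiable curve in `L²`, the fields `∇Du` and `ψ = H ∗ₓ ∇Du` are
continuous curves in `L²`, and the momentum equation holds for `t > 0` against test functions. -/
structure IsSolution (ρ : ℝ) (g : ℝ → ℝ) (H : Space → Matrix (GradIdx n) (GradIdx n) ℝ)
    (u v : ℝ → Fin n → L2) (G : ℝ → GradIdx n → L2) : Prop where
  velocity : ∀ t, 0 ≤ t → HasDerivWithinAt u (v t) (Ici 0) t
  continuousOn_velocity : ContinuousOn v (Ici 0)
  gradient : ∀ t, 0 ≤ t → ∀ i j, (G t (i, j) : 𝓢'(Space, ℂ)) = pderiv j (v t i : 𝓢'(Space, ℂ))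
  continuousOn_gradient : ContinuousOn G (Ici 0)
  domain : ∀ t, 0 ≤ t → InDomain H (G t)
  continuousOn_psi : ContinuousOn (fun t => symbolOp H (G t)) (Ici 0)
  momentum : ∀ t, 0 < t → ∀ (i : Fin n) (φ : 𝓢(Space, ℂ)),
    HasDerivAt (fun τ => (ρ : ℂ) * (v τ i : 𝓢'(Space, ℂ)) φ)
      (∑ j, pderiv j (stress g (fun τ => symbolOp H (G τ)) t (i, j) : 𝓢'(Space, ℂ)) φ) t

end NonlocalVisco

end

/-! Write `G = ∇Du`, `ψ = H G`, `σ = g ∗ ψ`. Both energies are expressed through the stress power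
`Re ⟨σ, G⟩`: the kinetic energy loses exactly this power, and `U(t)` is its integral over `[0, t]`.

Stored energy. A Fourier multiplier has a closed graph, so `ψ = H G` integrates in time to `y_ψ = H
y_G`, that is `H₋₁ y_ψ = y_G`. The stored density is therefore `⟨y_ψ, y_G⟩ = ∬ e^{is(a-τ)} K(a, τ)
da dτ` over `(0, t]²`, with the Hermitian kernel `K(a, τ) = ⟨ψ(a), G(τ)⟩`. In `s` it is the
transform of the correlation `c(r) = ∫ K(τ + r, τ) dτ`, continuous with compact support, and it is
nonnegative because `H` is. The spectral identity turns its `m`-integral into `∬ g(|a-τ|) K(a, τ)`,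
and Hermitian symmetry folds the square onto a triangle, giving `2 ∫ Re ⟨σ, G⟩`.

The correlation need not be smooth and `m` may have infinite mass, so the identity must be extended
from test functions. `IsSpectralMeasure.integrable_and_integral_expTransform` does this by
mollification; nonnegativity of the transform lets Fatou's lemma supply integrability.

Kinetic energy. The momentum equation holds only weakly, and no `L²` acceleration is available.
`IsSolution.kineticEnergy_sub` therefore works with increments: it pairs `v(b) + v(a)` with `ρ (v(b)
- v(a))`, the divergence of the time-integrated stress, and integrates by parts; difference
quotients then converge. -/

noncomputable section

namespace NonlocalVisco

/-! ### Fourier multipliers and their closed graphs. -/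

/-- An integral of a function with values in a closed subspace lies in the subspace. -/
theorem setIntegral_mem_of_isClosed {X E : Type*} [MeasurableSpace X] {μ : Measure X}
    [NormedAddCommGroup E] [NormedSpace ℂ E] [CompleteSpace E] (S : Submodule ℂ E)
    (hS : IsClosed (S : Set E)) {s : Set X} (hs : MeasurableSet s) {f : X → E}
    (hf : IntegrableOn f s μ) (hfS : ∀ x ∈ s, f x ∈ S) : ∫ x in s, f x ∂μ ∈ S := by
  have := hS.completeSpace_coe
  -- In the quotient by `S`, normed because `S` is closed, the integrand vanishes, hence so does the
  -- class of the integral.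
  have h := (S.mkQL).integral_comp_comm hf
  have h0 : ∫ x in s, S.mkQL (f x) ∂μ = 0 := by
    rw [setIntegral_congr_fun (g := fun _ => 0) hs]
    · simp
    · intro x hx
      simpa using hfS x hx
  rw [h0] at h
  simpa using h.symm

theorem exists_common_subseq_tendsto_ae {κ : Type*} [Finite κ] {p : ℕ → κ → L2} {q : κ → L2}
    (h : Tendsto p atTop (𝓝 q)) : ∃ ns : ℕ → ℕ, Tendsto ns atTop atTop ∧
      ∀ᵐ x, ∀ i, Tendsto (fun k => p (ns k) i x) atTop (𝓝 (q i x)) := by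
  classical
  have := Fintype.ofFinite κ
  suffices H : ∀ s : Finset κ, ∃ ns : ℕ → ℕ, Tendsto ns atTop atTop ∧
      ∀ i ∈ s, ∀ᵐ x, Tendsto (fun k => p (ns k) i x) atTop (𝓝 (q i x)) by
    obtain ⟨ns, h1, h2⟩ := H Finset.univ
    exact ⟨ns, h1, ae_all_iff.2 fun i => h2 i (Finset.mem_univ i)⟩
  intro s
  induction s using Finset.induction_on with
  | empty => exact ⟨id, tendsto_id, by simp⟩
  | insert i s _ ih =>
    obtain ⟨ns, h1, h2⟩ := ih
    have hi : Tendsto (fun k => p (ns k) i) atTop (𝓝 (q i)) :=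
      ((tendsto_pi_nhds.1 h) i).comp h1
    obtain ⟨ms, hm, hm'⟩ := (tendstoInMeasure_of_tendsto_Lp hi).exists_seq_tendsto_ae
    refine ⟨ns ∘ ms, h1.comp hm.tendsto_atTop, ?_⟩
    intro j hj
    rcases Finset.mem_insert.1 hj with rfl | hj
    · exact hm'
    · filter_upwards [h2 j hj] with x hx
      exact hx.comp hm.tendsto_atTop

section Multiplier

variable {ι : Type} [Fintype ι]

/-- The graph of the operator with matrix symbol `A`. -/
def symbolGraph (A : Space → Matrix ι ι ℝ) : Submodule ℂ ((ι → L2) × (ι → L2)) where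
  carrier := {p | ∀ a, (𝓕 (p.2 a) : L2) =ᵐ[volume] symbolMul A p.1 a}
  zero_mem' := by
    intro a
    have : ∀ᵐ ξ : Space, (0 : L2) ξ = 0 := Lp.coeFn_zero _ _ _
    filter_upwards [this] with ξ h
    simp only [symbolMul, Prod.snd_zero, Prod.fst_zero, Pi.zero_apply,
      FourierTransform.fourier_zero, h, mul_zero, Finset.sum_const_zero]
  add_mem' := by
    intro p q hp hq a
    have h1 : ∀ f g : L2, ∀ᵐ ξ : Space, (𝓕 (f + g) : L2) ξ = (𝓕 f : L2) ξ + (𝓕 g : L2) ξ := by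
      intro f g
      rw [FourierTransform.fourier_add]
      exact Lp.coeFn_add _ _
    filter_upwards [hp a, hq a, h1 (p.2 a) (q.2 a), ae_all_iff.2 fun b => h1 (p.1 b) (q.1 b)]
      with ξ e1 e2 e3 e4
    simp only [symbolMul] at e1 e2
    simp only [symbolMul, Prod.snd_add, Prod.fst_add, Pi.add_apply, e1, e2, e3, e4, mul_add,
      Finset.sum_add_distrib]
  smul_mem' := by
    intro c p hp a
    have h1 : ∀ f : L2, ∀ᵐ ξ : Space, (𝓕 (c • f) : L2) ξ = c * (𝓕 f : L2) ξ := by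
      intro f
      rw [FourierTransform.fourier_smul]
      exact Lp.coeFn_smul _ _
    filter_upwards [hp a, h1 (p.2 a), ae_all_iff.2 fun b => h1 (p.1 b)] with ξ e1 e3 e4
    simp only [symbolMul] at e1
    simp only [symbolMul, Prod.smul_snd, Prod.smul_fst, Pi.smul_apply, e1, e3, e4,
      Finset.mul_sum, mul_left_comm]

/-- Along a subsequence all components converge almost everywhere at once, and the pointwise finite
sum passes to the limit. No bound on the symbol is needed, so time integrals commute with an
unbounded multiplier. -/
theorem isClosed_symbolGraph (A : Space → Matrix ι ι ℝ) :
    IsClosed (symbolGraph A : Set ((ι → L2) × (ι → L2))) := by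
  refine IsSeqClosed.isClosed fun p q hp hpq => ?_
  have hF : ∀ (c : (ι → L2) × (ι → L2) → L2), Continuous c →
      Tendsto (fun n => (𝓕 (c (p n)) : L2)) atTop (𝓝 (𝓕 (c q))) := fun c hc =>
    ((continuous_fourier.comp hc).tendsto q).comp hpq
  let P : (ι → L2) × (ι → L2) → ι ⊕ ι → L2 := fun r =>
    Sum.elim (fun a => 𝓕 (r.1 a)) (fun a => 𝓕 (r.2 a))
  have hP : Tendsto (fun n => P (p n)) atTop (𝓝 (P q)) := by
    rw [tendsto_pi_nhds]
    rintro (a | a)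
    · exact hF (fun r => r.1 a) (by fun_prop)
    · exact hF (fun r => r.2 a) (by fun_prop)
  obtain ⟨ns, -, hns⟩ := exists_common_subseq_tendsto_ae hP
  intro a
  filter_upwards [hns, ae_all_iff.2 fun k => hp (ns k) a] with ξ h1 h2
  refine tendsto_nhds_unique (h1 (Sum.inr a)) ?_
  simp only [P, Sum.elim_inr, h2, symbolMul]
  exact tendsto_finsetSum _ fun b _ => (h1 (Sum.inl b)).const_mul _

theorem InDomain.mem_symbolGraph {A : Space → Matrix ι ι ℝ} {f : ι → L2} (hf : InDomain A f) :
    (f, symbolOp A f) ∈ symbolGraph A := by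
  intro a
  simp only [symbolOp, dif_pos (hf a)]
  rw [fourier_fourierInv_eq]
  exact (hf a).coeFn_toLp

theorem inDomain_of_mem_symbolGraph {A : Space → Matrix ι ι ℝ} {f h : ι → L2}
    (hfh : (f, h) ∈ symbolGraph A) : InDomain A f := fun a =>
  (memLp_congr_ae (hfh a)).1 (Lp.memLp _)

theorem symbolOp_eq_of_mem_symbolGraph {A : Space → Matrix ι ι ℝ} {f h : ι → L2}
    (hfh : (f, h) ∈ symbolGraph A) : symbolOp A f = h := by
  funext a
  have hd := inDomain_of_mem_symbolGraph hfh
  simp only [symbolOp, dif_pos (hd a)]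
  rw [show (hd a).toLp (symbolMul A f a) = 𝓕 (h a) from
    Lp.ext ((hd a).coeFn_toLp.trans (hfh a).symm), fourierInv_fourier_eq]

/-- The graph of the operator with the inverse symbol is the inverse graph. -/
theorem mem_symbolGraph_inv [DecidableEq ι] {A : Space → Matrix ι ι ℝ}
    (hA : ∀ k, k ≠ 0 → IsUnit (A k).det) {f h : ι → L2} (hfh : (f, h) ∈ symbolGraph A) :
    (h, f) ∈ symbolGraph fun k => (A k)⁻¹ := by
  intro a
  -- The symbol may be singular at the origin, a null set.
  have h0 : ∀ᵐ ξ : Space, ξ ≠ 0 := by simp [ae_iff]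
  filter_upwards [h0, ae_all_iff.2 hfh] with ξ hξ e
  have hk : (2 * Real.pi) • ξ ≠ 0 := smul_ne_zero (by positivity) hξ
  have hinv := Matrix.nonsing_inv_mul _ (hA _ hk)
  simp only [symbolMul, e, Finset.mul_sum]
  rw [Finset.sum_comm]
  have : ∀ c, ∑ b, (((A ((2 * Real.pi) • ξ))⁻¹ a b : ℝ) : ℂ) * (((A ((2 * Real.pi) • ξ)) b c : ℝ) *
      (𝓕 (f c) : L2) ξ) = if a = c then (𝓕 (f c) : L2) ξ else 0 := by
    intro c
    have := congrFun (congrFun hinv a) c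
    rw [Matrix.mul_apply, Matrix.one_apply] at this
    simp_rw [← mul_assoc, ← Finset.sum_mul]
    have h2 := congrArg (fun r : ℝ => (r : ℂ)) this
    push_cast at h2
    rw [h2]
    split_ifs <;> simp
  simp [this]

theorem sum_inner_eq_integral_fourier (f g : ι → L2) :
    ∑ a, inner ℂ (f a) (g a) = ∫ ξ, ∑ a, inner ℂ ((𝓕 (f a) : L2) ξ) ((𝓕 (g a) : L2) ξ) := by
  rw [integral_finsetSum _ fun a _ => L2.integrable_inner _ _]
  refine Finset.sum_congr rfl fun a _ => ?_
  rw [← Lp.inner_fourier_eq, L2.inner_def]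

/-- The operator with a symmetric real symbol is symmetric. -/
theorem sum_inner_symm_of_mem_symbolGraph {A : Space → Matrix ι ι ℝ}
    (hA : ∀ k, k ≠ 0 → (A k).IsSymm) {f h f' h' : ι → L2} (hfh : (f, h) ∈ symbolGraph A)
    (hfh' : (f', h') ∈ symbolGraph A) :
    ∑ a, inner ℂ (h a) (f' a) = ∑ a, inner ℂ (f a) (h' a) := by
  rw [sum_inner_eq_integral_fourier, sum_inner_eq_integral_fourier]
  have h0 : ∀ᵐ ξ : Space, ξ ≠ 0 := by simp [ae_iff]
  refine integral_congr_ae ?_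
  filter_upwards [h0, ae_all_iff.2 hfh, ae_all_iff.2 hfh'] with ξ hξ e e'
  have hk : (2 * Real.pi) • ξ ≠ 0 := smul_ne_zero (by positivity) hξ
  simp only [e, e', symbolMul, RCLike.inner_apply, map_sum, map_mul, Complex.conj_ofReal,
    Finset.mul_sum, Finset.sum_mul]
  rw [Finset.sum_comm]
  refine Finset.sum_congr rfl fun b _ => Finset.sum_congr rfl fun a _ => ?_
  rw [(hA _ hk).apply b a]
  ring

/-- The quadratic form of the operator with a positive semidefinite symbol is nonnegative. -/
theorem sum_inner_nonneg_of_mem_symbolGraph {A : Space → Matrix ι ι ℝ}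
    (hA : ∀ k, k ≠ 0 → (A k).PosSemidef) {f h : ι → L2} (hfh : (f, h) ∈ symbolGraph A) :
    0 ≤ (∑ a, inner ℂ (h a) (f a)).re := by
  rw [sum_inner_eq_integral_fourier]
  rw [← RCLike.re_eq_complex_re, ← integral_re (integrable_finsetSum _ fun a _ => L2.integrable_inner _ _)]
  refine integral_nonneg_of_ae ?_
  have h0 : ∀ᵐ ξ : Space, ξ ≠ 0 := by simp [ae_iff]
  filter_upwards [h0, ae_all_iff.2 hfh] with ξ hξ e
  have hk : (2 * Real.pi) • ξ ≠ 0 := smul_ne_zero (by positivity) hξ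
  have hp := (hA _ hk)
  -- Since the matrix is real, the real part of its form at a complex vector is the sum of its
  -- values at the real and imaginary parts.
  have h1 := hp.dotProduct_mulVec_nonneg (fun a => ((𝓕 (f a) : L2) ξ).re)
  have h2 := hp.dotProduct_mulVec_nonneg (fun a => ((𝓕 (f a) : L2) ξ).im)
  have h3 := add_nonneg h1 h2
  simp only [dotProduct, Matrix.mulVec, star_trivial, Pi.star_apply] at h3
  simp only [e, symbolMul, RCLike.inner_apply, map_sum, map_mul, Complex.conj_ofReal, Pi.zero_apply]
  refine h3.trans_eq ?_
  rw [← Finset.sum_add_distrib]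
  refine Finset.sum_congr rfl fun a _ => ?_
  simp only [Finset.mul_sum, map_sum]
  rw [← Finset.sum_add_distrib]
  refine Finset.sum_congr rfl fun b _ => ?_
  simp

/-- Weighted time integrals of curves in the graph of the operator stay in the graph. -/
theorem intervalIntegral_smul_mem_symbolGraph {A : Space → Matrix ι ι ℝ} {f h : ℝ → ι → L2}
    (hf : Continuous f) (hh : Continuous h) (hfh : ∀ τ, (f τ, h τ) ∈ symbolGraph A)
    {c : ℝ → ℂ} (hc : Continuous c) {t : ℝ} (ht : 0 ≤ t) :
    ((fun a => ∫ τ in (0 : ℝ)..t, c τ • f τ a), fun a => ∫ τ in (0 : ℝ)..t, c τ • h τ a) ∈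
      symbolGraph A := by
  -- The pair is integrated as a single curve in the closed graph, and the components are read off
  -- afterwards.
  have hcont : Continuous fun τ => c τ • (f τ, h τ) := by fun_prop
  have hint : IntegrableOn (fun τ => c τ • (f τ, h τ)) (Ioc 0 t) :=
    (hcont.integrableOn_Icc).mono_set Ioc_subset_Icc_self
  have key := setIntegral_mem_of_isClosed (symbolGraph A) (isClosed_symbolGraph A)
    measurableSet_Ioc hint fun τ _ => (symbolGraph A).smul_mem _ (hfh τ)
  convert key using 1
  refine Prod.ext ?_ ?_ <;> funext a
  · simp only [intervalIntegral.integral_of_le ht]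
    exact (((ContinuousLinearMap.proj (R := ℂ) a).comp
      (ContinuousLinearMap.fst ℂ (ι → L2) (ι → L2))).integral_comp_comm hint)
  · simp only [intervalIntegral.integral_of_le ht]
    exact (((ContinuousLinearMap.proj (R := ℂ) a).comp
      (ContinuousLinearMap.snd ℂ (ι → L2) (ι → L2))).integral_comp_comm hint)

end Multiplier

/-! ### The exponential transform and mollification. -/

/-- The transform `∫ e^{ist} f(t) dt`. -/
def expTransform (f : ℝ → ℂ) (s : ℝ) : ℂ := ∫ t : ℝ, Complex.exp (Complex.I * s * t) * f t

theorem expTransform_eq_fourier (f : ℝ → ℂ) (s : ℝ) :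
    expTransform f s = 𝓕 f (-(2 * Real.pi)⁻¹ * s) := by
  rw [Real.fourier_real_eq_integral_exp_smul]
  refine integral_congr_ae (Eventually.of_forall fun t => ?_)
  simp only [smul_eq_mul]
  congr 2
  have : (Real.pi : ℂ) ≠ 0 := by exact_mod_cast Real.pi_ne_zero
  push_cast
  field_simp

theorem continuous_expTransform {f : ℝ → ℂ} (hf : Integrable f) : Continuous (expTransform f) := by
  have h : Continuous (𝓕 f) := VectorFourier.fourierIntegral_continuous Real.continuous_fourierChar
    (by fun_prop) hf
  have : expTransform f = fun s => 𝓕 f (-(2 * Real.pi)⁻¹ * s) :=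
    funext (expTransform_eq_fourier f)
  rw [this]
  exact h.comp (by fun_prop)

theorem integrable_expTransform (m : Measure ℝ) [m.HasTemperateGrowth] (φ : 𝓢(ℝ, ℂ)) :
    Integrable (expTransform φ) m := by
  have hc : -(2 * Real.pi)⁻¹ ≠ 0 := by simp [Real.pi_ne_zero]
  let e : ℝ ≃L[ℝ] ℝ := ContinuousLinearEquiv.smulLeft (Units.mk0 _ hc)
  have := (SchwartzMap.compCLMOfContinuousLinearEquiv ℂ e (𝓕 φ)).integrable (μ := m)
  refine this.congr (Eventually.of_forall fun s => ?_)
  rw [expTransform_eq_fourier, ← SchwartzMap.fourier_coe]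
  rfl

section Mollifier

open ContinuousLinearMap Convolution

/-- Convolution with a normalised bump. -/
def mollify (θ : ContDiffBump (0 : ℝ)) (f : ℝ → ℂ) : ℝ → ℂ :=
  θ.normed volume ⋆[lsmul ℝ ℝ] f

variable (θ : ContDiffBump (0 : ℝ)) {f : ℝ → ℂ}

theorem contDiff_mollify (hf : LocallyIntegrable f) : ContDiff ℝ ∞ (mollify θ f) :=
  θ.hasCompactSupport_normed.contDiff_convolution_left _ θ.contDiff_normed hf

theorem hasCompactSupport_mollify (hf : HasCompactSupport f) : HasCompactSupport (mollify θ f) :=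
  θ.hasCompactSupport_normed.convolution _ hf

theorem norm_mollify_le {C : ℝ} (hC : ∀ x, ‖f x‖ ≤ C) (x : ℝ) : ‖mollify θ f x‖ ≤ C := by
  have := norm_integral_le_of_norm_le (f := fun t => θ.normed volume t • f (x - t))
    (g := fun t => θ.normed volume t * C) (μ := volume) (θ.integrable_normed.mul_const C)
    (Eventually.of_forall fun t => by
      rw [norm_smul, Real.norm_of_nonneg (θ.nonneg_normed t)]
      exact mul_le_mul_of_nonneg_left (hC _) (θ.nonneg_normed t))
  rwa [integral_mul_const, θ.integral_normed, one_mul] at this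

/-- The support grows by at most 1 whatever the bump, so one dominating function serves all
mollifications. -/
theorem mollify_eq_zero {R : ℝ} (hθ : θ.rOut ≤ 1) (hR : ∀ x, R < |x| → f x = 0) (x : ℝ)
    (hx : R + 1 < |x|) : mollify θ f x = 0 := by
  refine integral_eq_zero_of_ae (Eventually.of_forall fun t => ?_)
  by_cases ht : θ.normed volume t = 0
  · simp [ht]
  · have : t ∈ Metric.ball (0 : ℝ) θ.rOut := by rw [← θ.support_normed_eq (μ := volume)]; exact ht
    rw [Metric.mem_ball, dist_zero_right, Real.norm_eq_abs] at this
    have h2 := abs_sub_abs_le_abs_sub x t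
    simp [hR (x - t) (by linarith)]

theorem expTransform_mollify (hf : Integrable f) (s : ℝ) :
    expTransform (mollify θ f) s =
      expTransform (fun x => (θ.normed volume x : ℂ)) s * expTransform f s := by
  simp only [expTransform_eq_fourier]
  exact Real.fourier_mul_convolution_eq (f₁ := fun x => (θ.normed volume x : ℂ))
    θ.integrable_normed.ofReal hf _

/-- The transform of an even real bump is real. -/
theorem expTransform_normed_eq_ofReal (s : ℝ) :
    expTransform (fun x => (θ.normed volume x : ℂ)) s =
      ((expTransform (fun x => (θ.normed volume x : ℂ)) s).re : ℂ) := by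
  rw [eq_comm, ← Complex.conj_eq_iff_re, expTransform, ← integral_conj, ← integral_neg_eq_self]
  refine integral_congr_ae (Eventually.of_forall fun t => ?_)
  simp only [map_mul, ← Complex.exp_conj, Complex.conj_I, Complex.conj_ofReal, θ.normed_neg]
  simp

theorem norm_expTransform_normed_le (s : ℝ) :
    ‖expTransform (fun x => (θ.normed volume x : ℂ)) s‖ ≤ 1 := by
  rw [← θ.integral_normed (μ := volume)]
  refine norm_integral_le_of_norm_le θ.integrable_normed (Eventually.of_forall fun t => ?_)
  have : Complex.I * s * t = ((s * t : ℝ) : ℂ) * Complex.I := by push_cast; ring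
  rw [norm_mul, this, Complex.norm_exp_ofReal_mul_I, one_mul, Complex.norm_real,
    Real.norm_of_nonneg (θ.nonneg_normed t)]

theorem tendsto_expTransform_normed {θ : ℕ → ContDiffBump (0 : ℝ)}
    (hθ : Tendsto (fun n => (θ n).rOut) atTop (𝓝 0)) (s : ℝ) :
    Tendsto (fun n => expTransform (fun x => ((θ n).normed volume x : ℂ)) s) atTop (𝓝 1) := by
  -- The transform at `s` is the bump convolved with `x ↦ e^{-isx}`, evaluated at 0.
  have h := ContDiffBump.convolution_tendsto_right_of_continuous (μ := volume) hθ
    (g := fun x : ℝ => Complex.exp (Complex.I * s * ((-x : ℝ) : ℂ))) (by fun_prop) 0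
  simp only [neg_zero, Complex.ofReal_zero, mul_zero, Complex.exp_zero] at h
  refine h.congr fun n => ?_
  refine integral_congr_ae (Eventually.of_forall fun t => ?_)
  simp [mul_comm]

theorem tendsto_mollify_mollify {θ : ℕ → ContDiffBump (0 : ℝ)}
    (hθ : Tendsto (fun n => (θ n).rOut) atTop (𝓝 0)) (hf : Continuous f) (x : ℝ) :
    Tendsto (fun n => mollify (θ n) (mollify (θ n) f) x) atTop (𝓝 (f x)) := by
  refine ContDiffBump.convolution_tendsto_right (μ := volume) hθ ?_ ?_ tendsto_const_nhds
  · exact Eventually.of_forall fun n =>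
      (contDiff_mollify (θ n) hf.locallyIntegrable).continuous.aestronglyMeasurable
  -- The outer limit needs the inner mollification to converge jointly in the index and the point,
  -- hence the indexing by pairs.
  · refine ContDiffBump.convolution_tendsto_right (μ := volume)
      (φ := fun p : ℕ × ℝ => θ p.1) (g := fun _ => f) (k := fun p : ℕ × ℝ => p.2)
      (hθ.comp tendsto_fst) ?_ ?_ tendsto_snd
    · exact Eventually.of_forall fun _ => hf.aestronglyMeasurable
    · exact (hf.tendsto x).comp tendsto_snd

end Mollifier

/-! ### Extension of the spectral identity. -/

theorem locallyIntegrable_comp_abs {g : ℝ → ℝ} (hg : LocallyIntegrableOn g (Ici 0)) :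
    LocallyIntegrable fun t => g |t| := by
  have hpos : ∀ R, IntegrableOn (fun t => g |t|) (Icc 0 R) := fun R =>
    (hg.integrableOn_compact_subset Icc_subset_Ici_self isCompact_Icc).congr_fun
      (fun t ht => by simp [abs_of_nonneg ht.1]) measurableSet_Icc
  have hneg : ∀ R, IntegrableOn (fun t => g |t|) (Icc (-R) 0) := fun R => by
    have h := (hpos R).comp_neg
    simpa using h
  rw [locallyIntegrable_iff]
  intro k hk
  obtain ⟨R, hR⟩ := hk.isBounded.subset_closedBall 0
  refine ((hneg R).union (hpos R)).mono_set fun t ht => ?_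
  have := hR ht
  rw [Metric.mem_closedBall, dist_zero_right, Real.norm_eq_abs, abs_le] at this
  rcases le_total t 0 with h | h
  · exact Or.inl ⟨this.1, h⟩
  · exact Or.inr ⟨h, this.2⟩

/-- The spectral identity `∫ f̂ dm = ∫ g(|t|) f(t) dt` for continuous compactly supported functions
with a nonnegative transform, which is then integrable. -/
theorem IsSpectralMeasure.integrable_and_integral_expTransform {g : ℝ → ℝ}
    (hg : LocallyIntegrableOn g (Ici 0)) {m : Measure ℝ} (hm : IsSpectralMeasure g m) {f : ℝ → ℂ}
    (hf : Continuous f) (hfs : HasCompactSupport f) (h0 : ∀ s, 0 ≤ (expTransform f s).re)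
    (him : ∀ s, (expTransform f s).im = 0) :
    Integrable (expTransform f) m ∧ ∫ s, expTransform f s ∂m = ∫ t : ℝ, (g |t| : ℂ) * f t := by
  obtain ⟨hm1, hm2⟩ := hm
  have hfi : Integrable f := hf.integrable_of_hasCompactSupport hfs
  let θ : ℕ → ContDiffBump (0 : ℝ) := fun n =>
    ⟨1 / ((n : ℝ) + 1) / 2, 1 / ((n : ℝ) + 1), by positivity, half_lt_self (by positivity)⟩
  have hθ : Tendsto (fun n => (θ n).rOut) atTop (𝓝 0) := tendsto_one_div_add_atTop_nhds_zero_nat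
  have hθ1 : ∀ n, (θ n).rOut ≤ 1 := fun n => by
    change 1 / ((n : ℝ) + 1) ≤ 1
    rw [div_le_one (by positivity)]
    linarith [(Nat.cast_nonneg n : (0 : ℝ) ≤ n)]
  -- Mollifying twice multiplies the transform by the square of a real number: a factor in `[0, 1]`
  -- tending to 1, which preserves nonnegativity. A single mollification could change the sign.
  let φ : ℕ → ℝ → ℂ := fun n => mollify (θ n) (mollify (θ n) f)
  let a : ℕ → ℝ → ℝ := fun n s => (expTransform (fun x => ((θ n).normed volume x : ℂ)) s).re
  have hfn : ∀ n, Continuous (mollify (θ n) f) := fun n =>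
    (contDiff_mollify (θ n) hf.locallyIntegrable).continuous
  have hφd : ∀ n, ContDiff ℝ ∞ (φ n) := fun n => contDiff_mollify _ (hfn n).locallyIntegrable
  have hφs : ∀ n, HasCompactSupport (φ n) := fun n =>
    hasCompactSupport_mollify _ (hasCompactSupport_mollify _ hfs)
  have hφt : ∀ n s, expTransform (φ n) s = ((a n s ^ 2 : ℝ) : ℂ) * expTransform f s := by
    intro n s
    simp only [φ, a]
    rw [expTransform_mollify _ ((hfn n).integrable_of_hasCompactSupport
      (hasCompactSupport_mollify _ hfs)), expTransform_mollify _ hfi,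
      expTransform_normed_eq_ofReal (θ n) s]
    push_cast [Complex.ofReal_re]
    ring
  have ha1 : ∀ n s, a n s ^ 2 ≤ 1 := fun n s => by
    have := (Complex.abs_re_le_norm _).trans (norm_expTransform_normed_le (θ n) s)
    exact (sq_le_one_iff_abs_le_one _).2 this
  have hat : ∀ s, Tendsto (fun n => a n s ^ 2) atTop (𝓝 1) := fun s => by
    have := (Complex.continuous_re.tendsto _).comp (tendsto_expTransform_normed hθ s)
    simpa using this.pow 2
  have hφm : ∀ n, Integrable (expTransform (φ n)) m := fun n =>
    integrable_expTransform m ((hφs n).toSchwartzMap (hφd n))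
  have hφg : ∀ n, ∫ t : ℝ, (g |t| : ℂ) * φ n t = ∫ s, expTransform (φ n) s ∂m := fun n =>
    hm2 ((hφs n).toSchwartzMap (hφd n)) (hφs n)
  have hlim : Tendsto (fun n => ∫ t : ℝ, (g |t| : ℂ) * φ n t) atTop
      (𝓝 (∫ t : ℝ, (g |t| : ℂ) * f t)) := by
    obtain ⟨C, hC⟩ := hfs.exists_bound_of_continuous hf
    obtain ⟨R, hR⟩ := hfs.isCompact.isBounded.subset_closedBall 0
    have hR' : ∀ x, R < |x| → f x = 0 := fun x hx => by
      by_contra h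
      have := hR (subset_tsupport _ h)
      rw [Metric.mem_closedBall, dist_zero_right, Real.norm_eq_abs] at this
      linarith
    have hgl := locallyIntegrable_comp_abs hg
    refine tendsto_integral_of_dominated_convergence
      -- Each of the two mollifications widens the support by at most 1.
      (fun t => (Icc (-(R + 1 + 1)) (R + 1 + 1)).indicator (fun t => ‖g |t|‖ * C) t) ?_ ?_ ?_ ?_
    · exact fun n => (Complex.continuous_ofReal.comp_aestronglyMeasurable
        hgl.aestronglyMeasurable).mul (hφd n).continuous.aestronglyMeasurable
    · rw [integrable_indicator_iff measurableSet_Icc]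
      exact ((hgl.integrableOn_isCompact isCompact_Icc).norm).mul_const C
    · refine fun n => Eventually.of_forall fun t => ?_
      by_cases ht : t ∈ Icc (-(R + 1 + 1)) (R + 1 + 1)
      · rw [indicator_of_mem ht, norm_mul, Complex.norm_real]
        exact mul_le_mul_of_nonneg_left (norm_mollify_le _ (norm_mollify_le _ hC) t) (norm_nonneg _)
      · rw [indicator_of_notMem ht]
        have : φ n t = 0 := mollify_eq_zero _ (hθ1 n) (mollify_eq_zero _ (hθ1 n) hR') t (by
          by_contra h
          exact ht (abs_le.1 (not_lt.1 h)))
        simp [this]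
    · exact Eventually.of_forall fun t => (tendsto_mollify_mollify hθ hf t).const_mul _
  have hcont := continuous_expTransform hfi
  have hre : ∀ s, expTransform f s = ((expTransform f s).re : ℂ) := fun s =>
    Complex.ext (by simp) (by simp [him s])
  have hint : Integrable (expTransform f) m := by
    refine ⟨hcont.aestronglyMeasurable, ?_⟩
    -- The integrals against `g` converge, so they are bounded. They equal the `m`-integrals of the
    -- damped transforms, and Fatou's lemma removes the damping.
    obtain ⟨C, hC⟩ := ((Complex.continuous_re.tendsto _).comp hlim).bddAbove_range
    have hb : ∀ n, ∫⁻ s, ENNReal.ofReal (a n s ^ 2 * (expTransform f s).re) ∂m ≤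
        ENNReal.ofReal C := by
      intro n
      have e : ∀ s, a n s ^ 2 * (expTransform f s).re = (expTransform (φ n) s).re := fun s => by
        rw [hφt, Complex.re_ofReal_mul]
      simp only [e]
      refine (ofReal_integral_eq_lintegral_ofReal (hφm n).re
        (Eventually.of_forall fun s => by
          change 0 ≤ (expTransform (φ n) s).re
          rw [← e]; exact mul_nonneg (sq_nonneg _) (h0 s))).symm.trans_le ?_
      refine ENNReal.ofReal_le_ofReal ?_
      have h1 := integral_re (𝕜 := ℂ) (hφm n)
      refine (h1.trans ?_).trans_le (hC ⟨n, rfl⟩)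
      simp [hφg]
    have hfatou : ∫⁻ s, ENNReal.ofReal (expTransform f s).re ∂m ≤ ENNReal.ofReal C := by
      have hl : ∀ s, ENNReal.ofReal (expTransform f s).re =
          liminf (fun n => ENNReal.ofReal (a n s ^ 2 * (expTransform f s).re)) atTop := fun s => by
        refine (Tendsto.liminf_eq (ENNReal.tendsto_ofReal ?_)).symm
        simpa using (hat s).mul_const (expTransform f s).re
      simp only [hl]
      refine (lintegral_liminf_le' fun n => ?_).trans ?_
      · have := (hφm n).aestronglyMeasurable.aemeasurable
        have := (Complex.measurable_re.comp_aemeasurable this).ennreal_ofReal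
        refine this.congr (Eventually.of_forall fun s => ?_)
        simp only [Function.comp_apply, hφt, Complex.re_ofReal_mul]
      · exact liminf_le_of_le (by isBoundedDefault) fun b hb' => by
          obtain ⟨n, hn⟩ := hb'.exists
          exact hn.trans (hb n)
    rw [hasFiniteIntegral_iff_norm]
    refine lt_of_le_of_lt ?_ (hfatou.trans_lt ENNReal.ofReal_lt_top)
    refine lintegral_mono fun s => ENNReal.ofReal_le_ofReal ?_
    rw [hre s, Complex.norm_real, Real.norm_of_nonneg (h0 s), Complex.ofReal_re]
  refine ⟨hint, ?_⟩
  refine tendsto_nhds_unique ?_ hlim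
  simp only [hφg]
  refine tendsto_integral_of_dominated_convergence (fun s => ‖expTransform f s‖) (fun n =>
    (hφm n).aestronglyMeasurable) hint.norm (fun n => Eventually.of_forall fun s => ?_)
    (Eventually.of_forall fun s => ?_)
  · rw [hφt, norm_mul, Complex.norm_real, Real.norm_of_nonneg (sq_nonneg _)]
    exact mul_le_of_le_one_left (norm_nonneg _) (ha1 n s)
  · simp only [hφt]
    have := ((Complex.continuous_ofReal.tendsto _).comp (hat s)).mul_const (expTransform f s)
    simpa using this

/-! ### Correlations and double time integrals. -/

section Correlation

/-- The restriction of a kernel to the square `(0, t]²`. -/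
def squareKernel (K : ℝ → ℝ → ℂ) (t : ℝ) : ℝ × ℝ → ℂ :=
  (Ioc 0 t ×ˢ Ioc 0 t).indicator (Function.uncurry K)

/-- The integral of a kernel on the square `(0, t]²` along its diagonals. -/
def correlation (K : ℝ → ℝ → ℂ) (t r : ℝ) : ℂ := ∫ τ, squareKernel K t (τ + r, τ)

variable {K : ℝ → ℝ → ℂ} {t : ℝ}

theorem squareKernel_of_mem {a τ : ℝ} (ha : a ∈ Ioc 0 t) (hτ : τ ∈ Ioc 0 t) :
    squareKernel K t (a, τ) = K a τ :=
  indicator_of_mem (mk_mem_prod ha hτ) _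

theorem squareKernel_of_notMem_left {a τ : ℝ} (ha : a ∉ Ioc 0 t) : squareKernel K t (a, τ) = 0 :=
  indicator_of_notMem (fun h => ha h.1) _

theorem squareKernel_of_notMem_right {a τ : ℝ} (hτ : τ ∉ Ioc 0 t) : squareKernel K t (a, τ) = 0 :=
  indicator_of_notMem (fun h => hτ h.2) _

theorem measurable_squareKernel (hK : Continuous (Function.uncurry K)) :
    Measurable (squareKernel K t) :=
  hK.measurable.indicator (measurableSet_Ioc.prod measurableSet_Ioc)

theorem exists_norm_squareKernel_le (hK : Continuous (Function.uncurry K)) (t : ℝ) :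
    ∃ C, 0 ≤ C ∧ ∀ a τ, ‖squareKernel K t (a, τ)‖ ≤ (Ioc 0 t).indicator (fun _ => C) τ := by
  obtain ⟨C, hC⟩ := (isCompact_Icc.prod isCompact_Icc :
    IsCompact (Icc 0 t ×ˢ Icc 0 t)).exists_bound_of_continuousOn hK.continuousOn
  refine ⟨max C 0, le_max_right _ _, fun a τ => ?_⟩
  by_cases hτ : τ ∈ Ioc 0 t
  · rw [indicator_of_mem hτ]
    by_cases h : (a, τ) ∈ Ioc 0 t ×ˢ Ioc 0 t
    · rw [squareKernel, indicator_of_mem h]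
      exact (hC _ ⟨Ioc_subset_Icc_self h.1, Ioc_subset_Icc_self h.2⟩).trans (le_max_left _ _)
    · simp [squareKernel, indicator_of_notMem h]
  · rw [squareKernel, indicator_of_notMem hτ, indicator_of_notMem (fun h => hτ h.2), norm_zero]

theorem squareKernel_eq_zero {a τ : ℝ} (h : a - τ ∉ Icc (-t) t) : squareKernel K t (a, τ) = 0 := by
  refine indicator_of_notMem (fun h' => h ?_) _
  obtain ⟨⟨h1, h2⟩, h3, h4⟩ := h'
  simp only at h1 h2 h3 h4
  constructor <;> linarith

theorem correlation_eq_zero {r : ℝ} (h : r ∉ Icc (-t) t) : correlation K t r = 0 := by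
  refine integral_eq_zero_of_ae (Eventually.of_forall fun τ => squareKernel_eq_zero ?_)
  rwa [add_sub_cancel_left]

theorem hasCompactSupport_correlation : HasCompactSupport (correlation K t) :=
  HasCompactSupport.intro (isCompact_Icc (a := -t) (b := t)) fun _ h => correlation_eq_zero h

/-- Dominated convergence applies because, for fixed `r`, the cut-off kernel can jump only where `τ
+ r` is 0 or `t`, that is at two values of `τ`. -/
theorem continuous_correlation (hK : Continuous (Function.uncurry K)) :
    Continuous (correlation K t) := by
  obtain ⟨C, -, hC⟩ := exists_norm_squareKernel_le hK t
  refine continuous_iff_continuousAt.2 fun r => ?_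
  refine continuousAt_of_dominated (bound := (Ioc 0 t).indicator fun _ => C) ?_ ?_ ?_ ?_
  · exact Eventually.of_forall fun r =>
      ((measurable_squareKernel hK).comp (by fun_prop)).aestronglyMeasurable
  · exact Eventually.of_forall fun r => Eventually.of_forall fun τ => hC _ _
  · exact (integrable_indicator_iff measurableSet_Ioc).2 (by simp)
  · have h1 : ∀ᵐ τ : ℝ, τ ≠ -r := by simp [ae_iff]
    have h2 : ∀ᵐ τ : ℝ, τ ≠ t - r := by simp [ae_iff]
    filter_upwards [h1, h2] with τ h1 h2
    have hadd : ContinuousAt (fun r : ℝ => τ + r) r := by fun_prop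
    by_cases hτ : τ ∈ Ioc 0 t
    · rcases lt_or_gt_of_ne (show τ + r ≠ 0 by contrapose! h1; linarith) with h | h
      · refine (continuousAt_const (y := (0 : ℂ))).congr ?_
        filter_upwards [hadd.eventually_lt_const h] with r' hr'
        exact (squareKernel_of_notMem_left fun h' => absurd h'.1 (not_lt.2 hr'.le)).symm
      rcases lt_or_gt_of_ne (show τ + r ≠ t by contrapose! h2; linarith) with h' | h'
      · have hc : ContinuousAt (fun r => Function.uncurry K (τ + r, τ)) r := by fun_prop
        refine hc.congr ?_
        filter_upwards [hadd.eventually_lt_const h', hadd.eventually_const_lt h] with r' hr' hr2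
        exact (squareKernel_of_mem ⟨hr2, hr'.le⟩ hτ).symm
      · refine (continuousAt_const (y := (0 : ℂ))).congr ?_
        filter_upwards [hadd.eventually_const_lt h'] with r' hr'
        exact (squareKernel_of_notMem_left fun h' => absurd h'.2 (not_le.2 hr')).symm
    · refine (continuousAt_const (y := (0 : ℂ))).congr (Eventually.of_forall fun r' => ?_)
      exact (squareKernel_of_notMem_right hτ).symm

/-- Only differences in `[-t, t]` occur, so the integrand is dominated by that of a convolution of
two integrable functions, the truncated `‖h‖` and a constant on `(0, t]`. -/
theorem integrable_mul_squareKernel (hK : Continuous (Function.uncurry K)) {h : ℝ → ℂ}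
    (hh : LocallyIntegrable h) :
    Integrable fun p : ℝ × ℝ => h (p.1 - p.2) * squareKernel K t p := by
  obtain ⟨C, hC0, hC⟩ := exists_norm_squareKernel_le hK t
  have hi : Integrable ((Icc (-t) t).indicator h) :=
    (integrable_indicator_iff measurableSet_Icc).2 (hh.integrableOn_isCompact isCompact_Icc)
  have hi2 : Integrable ((Ioc 0 t).indicator fun _ => C) :=
    (integrable_indicator_iff measurableSet_Ioc).2 (by simp)
  refine (hi2.convolution_integrand (ContinuousLinearMap.mul ℝ ℝ) hi.norm).mono' ?_ ?_
  · exact (hh.aestronglyMeasurable.comp_quasiMeasurePreserving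
      (quasiMeasurePreserving_sub_of_right_invariant volume volume)).mul
      (measurable_squareKernel hK).aestronglyMeasurable
  · refine Eventually.of_forall fun ⟨a, τ⟩ => ?_
    simp only [ContinuousLinearMap.mul_apply']
    by_cases hr : a - τ ∈ Icc (-t) t
    · rw [indicator_of_mem hr, norm_mul, mul_comm]
      exact mul_le_mul_of_nonneg_right (hC a τ) (norm_nonneg _)
    · rw [squareKernel_eq_zero hr, indicator_of_notMem hr]
      simp

/-- Integration against the correlation is integration over the square. -/
theorem integral_mul_correlation (hK : Continuous (Function.uncurry K)) {h : ℝ → ℂ}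
    (hh : LocallyIntegrable h) :
    ∫ r, h r * correlation K t r =
      ∫ τ in Ioc 0 t, ∫ a in Ioc 0 t, h (a - τ) * K a τ := by
  obtain ⟨C, hC0, hC⟩ := exists_norm_squareKernel_le hK t
  have hi : Integrable ((Icc (-t) t).indicator h) :=
    (integrable_indicator_iff measurableSet_Icc).2 (hh.integrableOn_isCompact isCompact_Icc)
  have hi2 : Integrable ((Ioc 0 t).indicator fun _ => C) :=
    (integrable_indicator_iff measurableSet_Ioc).2 (by simp)
  have hint : Integrable (Function.uncurry fun r τ => h r * squareKernel K t (τ + r, τ)) := by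
    refine (hi.norm.mul_prod hi2).mono' ?_ ?_
    · exact (hh.aestronglyMeasurable.comp_fst).mul
        ((measurable_squareKernel hK).comp (by fun_prop)).aestronglyMeasurable
    · refine Eventually.of_forall fun ⟨r, τ⟩ => ?_
      simp only [Function.uncurry_apply_pair]
      by_cases hr : r ∈ Icc (-t) t
      · rw [indicator_of_mem hr, norm_mul]
        exact mul_le_mul_of_nonneg_left (hC _ _) (norm_nonneg _)
      · rw [squareKernel_eq_zero (by rwa [add_sub_cancel_left]), indicator_of_notMem hr]
        simp
  calc ∫ r, h r * correlation K t r = ∫ r, ∫ τ, h r * squareKernel K t (τ + r, τ) := by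
        simp only [correlation, integral_const_mul]
    _ = ∫ τ, ∫ r, h r * squareKernel K t (τ + r, τ) := integral_integral_swap hint
    _ = ∫ τ, ∫ a, h (a - τ) * squareKernel K t (a, τ) := by
        refine integral_congr_ae (Eventually.of_forall fun τ => ?_)
        simp only
        rw [← integral_sub_right_eq_self _ τ]
        simp
    _ = _ := by
        rw [← integral_indicator measurableSet_Ioc]
        refine integral_congr_ae (Eventually.of_forall fun τ => ?_)
        by_cases hτ : τ ∈ Ioc 0 t
        · simp only
          rw [indicator_of_mem hτ, ← integral_indicator measurableSet_Ioc]
          refine integral_congr_ae (Eventually.of_forall fun a => ?_)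
          by_cases ha : a ∈ Ioc 0 t
          · simp only [indicator_of_mem ha, squareKernel_of_mem ha hτ]
          · simp only [indicator_of_notMem ha, squareKernel_of_notMem_left ha, mul_zero]
        · simp only [indicator_of_notMem hτ, squareKernel_of_notMem_right hτ, mul_zero,
            integral_zero]

/-- A Hermitian integrand over the square contributes twice the real part of the triangle. -/
theorem integral_square_eq_two_re_triangle (hK : Continuous (Function.uncurry K))
    (hherm : ∀ a τ, K τ a = (starRingEnd ℂ) (K a τ)) {g : ℝ → ℝ}
    (hg : LocallyIntegrable fun r => g |r|) (ht : 0 ≤ t) :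
    ∫ τ in Ioc 0 t, ∫ a in Ioc 0 t, (g |a - τ| : ℂ) * K a τ =
      ((2 * (∫ τ in (0 : ℝ)..t, ∫ a in (0 : ℝ)..τ, (g (τ - a) : ℂ) * K a τ).re : ℝ) : ℂ) := by
  have hgc : LocallyIntegrable fun r => (g |r| : ℂ) := by
    rw [locallyIntegrable_iff] at hg ⊢
    exact fun k hk => (hg k hk).ofReal
  have hF := integrable_mul_squareKernel (t := t) hK hgc
  set F : ℝ × ℝ → ℂ := fun p => (g |p.1 - p.2| : ℂ) * squareKernel K t p with hFdef
  have hFherm : ∀ a τ, F (τ, a) = (starRingEnd ℂ) (F (a, τ)) := by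
    intro a τ
    simp only [hFdef, map_mul, Complex.conj_ofReal, abs_sub_comm a τ, squareKernel]
    congr 1
    by_cases h : (a, τ) ∈ Ioc 0 t ×ˢ Ioc 0 t
    · rw [indicator_of_mem h, indicator_of_mem (mk_mem_prod h.2 h.1)]
      exact hherm a τ
    · rw [indicator_of_notMem h, indicator_of_notMem (fun h' => h ⟨h'.2, h'.1⟩), map_zero]
  let T : Set (ℝ × ℝ) := {p | p.1 < p.2}
  have hT : MeasurableSet T := measurableSet_lt measurable_fst measurable_snd
  have hTF : Integrable (T.indicator F) := hF.indicator hT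
  have hTF' : Integrable (fun p => T.indicator F (p : ℝ × ℝ).swap) := hTF.swap
  have hdiag : ∀ᵐ p : ℝ × ℝ, p.1 ≠ p.2 := by
    have hm : MeasurableSet {p : ℝ × ℝ | p.1 ≠ p.2} :=
      (measurableSet_eq_fun measurable_fst measurable_snd).compl
    rw [Measure.volume_eq_prod, Measure.ae_prod_iff_ae_ae hm]
    refine Eventually.of_forall fun a => ?_
    have : ∀ᵐ y : ℝ, y ≠ a := by simp [ae_iff]
    filter_upwards [this] with y hy using hy.symm
  -- Up to the null diagonal, the plane is the half-plane `T` and its mirror image, on which `F`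
  -- takes conjugate values.
  have hsplit : ∫ p, F p = (∫ p, T.indicator F p) + (starRingEnd ℂ) (∫ p, T.indicator F p) := by
    rw [← integral_conj]
    have : ∫ p, (starRingEnd ℂ) (T.indicator F p) =
        ∫ p : ℝ × ℝ, (starRingEnd ℂ) (T.indicator F p.swap) := by
      rw [Measure.volume_eq_prod, integral_prod_swap (fun p => (starRingEnd ℂ) (T.indicator F p))]
    rw [this, ← integral_add hTF (by
      exact (Complex.conjLIE.toContinuousLinearEquiv : ℂ →L[ℝ] ℂ).integrable_comp hTF')]
    refine integral_congr_ae ?_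
    filter_upwards [hdiag] with ⟨a, τ⟩ hne
    rcases lt_or_gt_of_ne hne with h | h
    · have h1 : (a, τ) ∈ T := h
      have h2 : (a, τ).swap ∉ T := not_lt.2 (le_of_lt h)
      rw [indicator_of_mem h1, indicator_of_notMem h2, map_zero, add_zero]
    · have h1 : (a, τ) ∉ T := not_lt.2 (le_of_lt h)
      have h2 : (a, τ).swap ∈ T := h
      rw [indicator_of_notMem h1, indicator_of_mem h2, zero_add, Prod.swap_prod_mk, hFherm a τ,
        Complex.conj_conj]
  have hL : ∫ τ in Ioc 0 t, ∫ a in Ioc 0 t, (g |a - τ| : ℂ) * K a τ = ∫ p, F p := by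
    rw [Measure.volume_eq_prod, integral_prod_symm _ hF, ← integral_indicator measurableSet_Ioc]
    refine integral_congr_ae (Eventually.of_forall fun τ => ?_)
    by_cases hτ : τ ∈ Ioc 0 t
    · simp only
      rw [indicator_of_mem hτ, ← integral_indicator measurableSet_Ioc]
      refine integral_congr_ae (Eventually.of_forall fun a => ?_)
      by_cases ha : a ∈ Ioc 0 t
      · simp only [hFdef, indicator_of_mem ha, squareKernel_of_mem ha hτ]
      · simp only [hFdef, indicator_of_notMem ha, squareKernel_of_notMem_left ha, mul_zero]
    · simp only [hFdef, indicator_of_notMem hτ, squareKernel_of_notMem_right hτ, mul_zero,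
        integral_zero]
  have hR : ∫ p, T.indicator F p =
      ∫ τ in (0 : ℝ)..t, ∫ a in (0 : ℝ)..τ, (g (τ - a) : ℂ) * K a τ := by
    rw [Measure.volume_eq_prod, integral_prod_symm _ hTF, intervalIntegral.integral_of_le ht,
      ← integral_indicator measurableSet_Ioc]
    refine integral_congr_ae (Eventually.of_forall fun τ => ?_)
    by_cases hτ : τ ∈ Ioc 0 t
    · rw [indicator_of_mem hτ, intervalIntegral.integral_of_le hτ.1.le,
        ← integral_indicator measurableSet_Ioc]
      have hne : ∀ᵐ y : ℝ, y ≠ τ := by simp [ae_iff]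
      refine integral_congr_ae ?_
      filter_upwards [hne] with a hne
      by_cases ha : a ∈ Ioc 0 τ
      · have h1 : (a, τ) ∈ T := lt_of_le_of_ne ha.2 hne
        rw [indicator_of_mem ha, indicator_of_mem h1]
        simp only [hFdef]
        rw [squareKernel_of_mem ⟨ha.1, ha.2.trans hτ.2⟩ hτ, abs_sub_comm,
          abs_of_nonneg (sub_nonneg.2 ha.2)]
      · rw [indicator_of_notMem ha]
        by_cases h1 : (a, τ) ∈ T
        · rw [indicator_of_mem h1]
          have h2 : a ∉ Ioc 0 t := fun h' => ha ⟨h'.1, le_of_lt h1⟩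
          simp only [hFdef, squareKernel_of_notMem_left h2, mul_zero]
        · rw [indicator_of_notMem h1]
    · rw [indicator_of_notMem hτ]
      refine integral_eq_zero_of_ae (Eventually.of_forall fun a => ?_)
      have : F (a, τ) = 0 := by
        simp only [hFdef, squareKernel_of_notMem_right hτ, mul_zero]
      simp only [indicator, this, ite_self, Pi.zero_apply]
  rw [hL, hsplit, hR, Complex.add_conj]

/-- The spectral representation of the energy form of a Hermitian kernel. -/
theorem IsSpectralMeasure.integrable_and_integral_energy {g : ℝ → ℝ}
    (hg : LocallyIntegrableOn g (Ici 0)) {m : Measure ℝ} (hm : IsSpectralMeasure g m)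
    (hK : Continuous (Function.uncurry K)) (hherm : ∀ a τ, K τ a = (starRingEnd ℂ) (K a τ))
    (ht : 0 ≤ t) {Q : ℝ → ℂ}
    (hQ : ∀ s, Q s = ∫ τ in (0 : ℝ)..t, ∫ a in (0 : ℝ)..t,
      Complex.exp (Complex.I * s * (a - τ)) * K a τ)
    (h0 : ∀ s, 0 ≤ (Q s).re) (him : ∀ s, (Q s).im = 0) :
    Integrable Q m ∧ ∫ s, Q s ∂m =
      ((2 * (∫ τ in (0 : ℝ)..t, ∫ a in (0 : ℝ)..τ, (g (τ - a) : ℂ) * K a τ).re : ℝ) : ℂ) := by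
  -- The phase depends only on `a - τ`, so integrating first along the diagonals gives a transform
  -- in one variable.
  have hQ' : expTransform (correlation K t) = Q := by
    funext s
    have hc : Continuous fun r : ℝ => Complex.exp (Complex.I * s * r) := by fun_prop
    rw [expTransform, integral_mul_correlation hK hc.locallyIntegrable, hQ,
      intervalIntegral.integral_of_le ht]
    refine integral_congr_ae (Eventually.of_forall fun τ => ?_)
    simp only [intervalIntegral.integral_of_le ht, Complex.ofReal_sub]
  have habs := locallyIntegrable_comp_abs hg
  have hgc : LocallyIntegrable fun r => (g |r| : ℂ) := by
    rw [locallyIntegrable_iff] at habs ⊢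
    exact fun k hk => (habs k hk).ofReal
  have key := hm.integrable_and_integral_expTransform hg (continuous_correlation (t := t) hK)
    hasCompactSupport_correlation (by simpa [hQ'] using h0) (by simpa [hQ'] using him)
  rw [hQ'] at key
  refine ⟨key.1, key.2.trans ?_⟩
  rw [integral_mul_correlation hK hgc]
  exact integral_square_eq_two_re_triangle hK hherm habs ht

end Correlation

/-! ### Curves on the half line and causal convolution. -/

section Curves

variable {E : Type*} [NormedAddCommGroup E] [NormedSpace ℝ E]

/-- Freezing a curve at its initial value for negative times makes it continuous on all of `ℝ`;
integrals over `[0, t]` do not see the extension. -/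
theorem _root_.ContinuousOn.continuous_comp_max {E : Type*} [TopologicalSpace E] {f : ℝ → E}
    (hf : ContinuousOn f (Ici 0)) : Continuous fun τ => f (max 0 τ) :=
  hf.comp_continuous (by fun_prop) fun τ => le_max_left 0 τ

theorem hasDerivWithinAt_integral_Ici [CompleteSpace E] {f : ℝ → E} (hf : ContinuousOn f (Ici 0))
    {t : ℝ} (ht : 0 ≤ t) :
    HasDerivWithinAt (fun τ => ∫ x in (0 : ℝ)..τ, f x) (f t) (Ici 0) t := by
  have hc := hf.continuous_comp_max
  have h := (intervalIntegral.integral_hasDerivAt_right (hc.intervalIntegrable 0 t)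
    (hc.stronglyMeasurableAtFilter _ _) hc.continuousAt).hasDerivWithinAt (s := Ici 0)
  rw [max_eq_right ht] at h
  refine h.congr (fun τ hτ => ?_) ?_ <;>
  · refine intervalIntegral.integral_congr fun x hx => ?_
    rw [uIcc_of_le (by assumption)] at hx
    simp [max_eq_right hx.1]

/-- The causal convolution of a locally integrable kernel with a continuous curve is continuous. -/
theorem continuousOn_causal_convolution [NormedSpace ℂ E] {g : ℝ → ℝ}
    (hg : LocallyIntegrableOn g (Ici 0)) {ψ : ℝ → E} (hψ : Continuous ψ) :
    ContinuousOn (fun t => ∫ τ in (0 : ℝ)..t, (g (t - τ) : ℂ) • ψ τ) (Ici 0) := by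
  intro t ht
  have ht : 0 ≤ t := ht
  have hgi : IntegrableOn g (Ioc 0 (t + 1)) :=
    (hg.integrableOn_compact_subset Icc_subset_Ici_self isCompact_Icc).mono_set Ioc_subset_Icc_self
  obtain ⟨C, hC⟩ := (isCompact_Icc : IsCompact (Icc (-(t + 1)) (t + 1))).exists_bound_of_continuousOn
    hψ.continuousOn
  have hC0 : 0 ≤ C := (norm_nonneg _).trans (hC 0 ⟨by linarith, by linarith⟩)
  -- After the substitution `r = t' - τ` the possibly unbounded kernel no longer moves with `t'`;
  -- only the continuous curve and the cut-off `r ≤ t'` do.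
  let F : ℝ → ℝ → E := fun t' => (Iic t').indicator fun r => (g r : ℂ) • ψ (t' - r)
  have key : ContinuousWithinAt (fun t' => ∫ r in Ioc 0 (t + 1), F t' r) (Icc 0 (t + 1)) t := by
    refine continuousWithinAt_of_dominated (bound := fun r => ‖g r‖ * C) ?_ ?_ ?_ ?_
    · refine Eventually.of_forall fun t' => AEStronglyMeasurable.indicator ?_ measurableSet_Iic
      exact (Complex.continuous_ofReal.comp_aestronglyMeasurable hgi.aestronglyMeasurable).smul
        (hψ.comp (by fun_prop)).aestronglyMeasurable
    · filter_upwards [self_mem_nhdsWithin] with t' ht'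
      filter_upwards [ae_restrict_mem measurableSet_Ioc] with r hr
      by_cases h : r ∈ Iic t'
      · simp only [F, indicator_of_mem h, norm_smul, Complex.norm_real]
        refine mul_le_mul_of_nonneg_left (hC _ ⟨?_, ?_⟩) (norm_nonneg _)
        · linarith [ht'.1, hr.2]
        · linarith [ht'.2, hr.1]
      · simp only [F, indicator_of_notMem h, norm_zero]
        positivity
    · exact hgi.norm.mul_const C
    · have hne : ∀ᵐ r : ℝ, r ≠ t := by simp [ae_iff]
      refine ae_restrict_of_ae ?_
      filter_upwards [hne] with r hr
      refine ContinuousAt.continuousWithinAt ?_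
      rcases lt_or_gt_of_ne hr with h | h
      · have hc : ContinuousAt (fun t' => (g r : ℂ) • ψ (t' - r)) t := by fun_prop
        refine hc.congr ?_
        filter_upwards [lt_mem_nhds h] with t' ht'
        exact (indicator_of_mem (s := Iic t') (le_of_lt ht') fun r => (g r : ℂ) • ψ (t' - r)).symm
      · refine (continuousAt_const (y := (0 : E))).congr ?_
        filter_upwards [gt_mem_nhds h] with t' ht'
        exact (indicator_of_notMem (s := Iic t') (not_le.2 ht') fun r => (g r : ℂ) • ψ (t' - r)).symm
  have heq : ∀ t' ∈ Icc 0 (t + 1), ∫ τ in (0 : ℝ)..t', (g (t' - τ) : ℂ) • ψ τ =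
      ∫ r in Ioc 0 (t + 1), F t' r := by
    intro t' ht'
    have h1 := intervalIntegral.integral_comp_sub_left (a := 0) (b := t')
      (fun r => (g r : ℂ) • ψ (t' - r)) t'
    simp only [sub_sub_cancel, sub_self, sub_zero] at h1
    rw [h1, intervalIntegral.integral_of_le ht'.1, setIntegral_indicator measurableSet_Iic]
    congr 2
    ext r
    simp only [mem_Ioc, mem_inter_iff, mem_Iic]
    constructor
    · exact fun h => ⟨⟨h.1, h.2.trans ht'.2⟩, h.2⟩
    · exact fun h => ⟨h.1.1, h.2⟩
  have hw := key.congr heq (heq t ⟨ht, by linarith⟩)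
  refine hw.mono_of_mem_nhdsWithin ?_
  filter_upwards [self_mem_nhdsWithin, mem_nhdsWithin_of_mem_nhds (gt_mem_nhds (lt_add_one t))]
    with t' h1 h2 using ⟨h1, le_of_lt h2⟩

theorem inner_intervalIntegral {F : Type*} [NormedAddCommGroup F] [InnerProductSpace ℂ F]
    [NormedSpace ℝ F] [IsScalarTower ℝ ℂ F] [CompleteSpace F] {f : ℝ → F} {a b : ℝ}
    (hf : IntervalIntegrable f volume a b) (c : F) :
    inner ℂ c (∫ x in a..b, f x) = ∫ x in a..b, inner ℂ c (f x) :=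
  (((innerSL ℂ c).restrictScalars ℝ).intervalIntegral_comp_comm hf).symm

theorem intervalIntegral_inner {F : Type*} [NormedAddCommGroup F] [InnerProductSpace ℂ F]
    [NormedSpace ℝ F] [IsScalarTower ℝ ℂ F] [CompleteSpace F] {f : ℝ → F} {a b : ℝ}
    (hf : IntervalIntegrable f volume a b) (c : F) :
    inner ℂ (∫ x in a..b, f x) c = ∫ x in a..b, inner ℂ (f x) c := by
  rw [← inner_conj_symm, inner_intervalIntegral hf]
  simp only [intervalIntegral, map_sub, ← integral_conj, inner_conj_symm]

end Curves

/-! ### Weak derivatives on the Fourier side. -/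

section Distribution

/-- Evaluation of an `L²` field at a Schwartz function, as a continuous functional of the field. -/
def evalSchwartz (φ : 𝓢(Space, ℂ)) : L2 →L[ℂ] ℂ :=
  (PointwiseConvergenceCLM.evalCLM (RingHom.id ℂ) ℂ φ).comp
    (Lp.toTemperedDistributionCLM ℂ (volume : Measure Space) 2)

theorem evalSchwartz_apply (φ : 𝓢(Space, ℂ)) (f : L2) :
    evalSchwartz φ f = (f : 𝓢'(Space, ℂ)) φ := rfl

theorem pderiv_apply (j : Fin 3) (f : L2) (φ : 𝓢(Space, ℂ)) :
    pderiv j (f : 𝓢'(Space, ℂ)) φ =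
      evalSchwartz (-∂_{(EuclideanSpace.single j (1 : ℝ) : Space)} φ) f := rfl

theorem fourier_pderiv_apply (j : Fin 3) (f : L2) (φ : 𝓢(Space, ℂ)) :
    (𝓕 (pderiv j (f : 𝓢'(Space, ℂ)))) φ =
      ∫ ξ, φ ξ * (2 * Real.pi * Complex.I * (ξ j : ℝ) * (𝓕 f : L2) ξ) := by
  have ht' : (fun ξ : Space =>
      ((inner ℝ ξ (EuclideanSpace.single j (1 : ℝ)) : ℝ) : ℂ)).HasTemperateGrowth := by
    fun_prop
  rw [pderiv, TemperedDistribution.fourier_lineDerivOp_eq, Lp.fourier_toTemperedDistribution_eq]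
  change (2 * Real.pi * Complex.I) * ((TemperedDistribution.smulLeftCLM ℂ
    (fun ξ : Space => ((inner ℝ ξ (EuclideanSpace.single j (1 : ℝ)) : ℝ) : ℂ)))
    (Lp.toTemperedDistribution (𝓕 f : L2))) φ = _
  rw [TemperedDistribution.smulLeftCLM_apply_apply, Lp.toTemperedDistribution_apply,
    ← integral_const_mul]
  refine integral_congr_ae (Eventually.of_forall fun ξ => ?_)
  beta_reduce
  rw [SchwartzMap.smulLeftCLM_apply_apply ht']
  simp only [EuclideanSpace.inner_single_right, smul_eq_mul, conj_trivial, one_mul]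
  ring

theorem locallyIntegrable_mul_fourier (j : Fin 3) (f : L2) : LocallyIntegrable fun ξ : Space =>
    2 * Real.pi * Complex.I * (ξ j : ℝ) * (𝓕 f : L2) ξ := by
  have h : LocallyIntegrable ((𝓕 f : L2) : Space → ℂ) :=
    (Lp.memLp (𝓕 f : L2)).locallyIntegrable one_le_two
  rw [← locallyIntegrableOn_univ] at h ⊢
  refine h.continuousOn_mul ?_ isOpen_univ.isLocallyClosed
  fun_prop

/-- The Fourier transform of a divergence. -/
theorem fourier_eq_of_eq_sum_pderiv {κ : Type*} [Fintype κ] {f : L2} {j : κ → Fin 3} {F : κ → L2}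
    (h : ∀ φ, (f : 𝓢'(Space, ℂ)) φ = ∑ i, pderiv (j i) (F i : 𝓢'(Space, ℂ)) φ) :
    ∀ᵐ ξ, (𝓕 f : L2) ξ = ∑ i, 2 * Real.pi * Complex.I * (ξ (j i) : ℝ) * (𝓕 (F i) : L2) ξ := by
  -- The terms on the right are only locally integrable, since a single derivative need not be in
  -- `L²`; hence the test against compactly supported functions.
  refine ae_eq_of_integral_contDiff_smul_eq
    ((Lp.memLp (𝓕 f : L2)).locallyIntegrable one_le_two)
    (locallyIntegrable_finsetSum _ fun i _ => locallyIntegrable_mul_fourier (j i) (F i))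
    fun g hg hgs => ?_
  have hgs' : HasCompactSupport fun ξ => (g ξ : ℂ) := hgs.comp_left Complex.ofReal_zero
  let φ : 𝓢(Space, ℂ) := hgs'.toSchwartzMap (Complex.ofRealCLM.contDiff.comp hg)
  have hφ : ∀ ξ, φ ξ = (g ξ : ℂ) := fun _ => rfl
  have e1 : ∫ ξ, g ξ • (𝓕 f : L2) ξ = (f : 𝓢'(Space, ℂ)) (𝓕 φ) := by
    rw [← TemperedDistribution.fourier_apply, Lp.fourier_toTemperedDistribution_eq,
      Lp.toTemperedDistribution_apply]
    rfl
  rw [e1, h]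
  simp only [Finset.smul_sum]
  rw [integral_finsetSum _ fun i _ =>
    (locallyIntegrable_mul_fourier (j i) (F i)).integrable_smul_left_of_hasCompactSupport
      hg.continuous hgs]
  refine Finset.sum_congr rfl fun i _ => ?_
  rw [← TemperedDistribution.fourier_apply, fourier_pderiv_apply]
  refine integral_congr_ae (Eventually.of_forall fun ξ => ?_)
  simp only [hφ, Complex.real_smul]

/-- Integration by parts for `L²` fields with `L²` weak derivatives. -/
theorem inner_eq_neg_sum_inner {w f : L2} {P F : Fin 3 → L2}
    (hP : ∀ j φ, (P j : 𝓢'(Space, ℂ)) φ = pderiv j (w : 𝓢'(Space, ℂ)) φ)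
    (hf : ∀ φ, (f : 𝓢'(Space, ℂ)) φ = ∑ j, pderiv j (F j : 𝓢'(Space, ℂ)) φ) :
    inner ℂ w f = -∑ j, inner ℂ (P j) (F j) := by
  rw [sum_inner_eq_integral_fourier, ← Lp.inner_fourier_eq, L2.inner_def, ← integral_neg]
  have h1 : ∀ j, ∀ᵐ ξ, (𝓕 (P j) : L2) ξ =
      ∑ _i : Unit, 2 * Real.pi * Complex.I * (ξ j : ℝ) * (𝓕 w : L2) ξ := fun j =>
    fourier_eq_of_eq_sum_pderiv (κ := Unit) (j := fun _ => j) (F := fun _ => w)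
      (by simpa using hP j)
  refine integral_congr_ae ?_
  filter_upwards [fourier_eq_of_eq_sum_pderiv (j := id) hf, ae_all_iff.2 h1] with ξ e1 e2
  simp only [Finset.univ_unique, Finset.sum_singleton] at e2
  -- The minus sign is that of the conjugate of `2πi ξ_j`.
  simp only [e1, e2, RCLike.inner_apply, Finset.sum_mul, id, map_mul, Complex.conj_ofReal,
    Complex.conj_I, map_ofNat, ← Finset.sum_neg_distrib]
  refine Finset.sum_congr rfl fun j _ => ?_
  ring

end Distribution

/-! ### Balance of the kinetic energy. -/

variable {n : ℕ}

theorem stress_congr {g : ℝ → ℝ} {ψ ψ' : ℝ → GradIdx n → L2} (h : ∀ τ, 0 ≤ τ → ψ τ = ψ' τ) {t : ℝ}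
    (ht : 0 ≤ t) : stress g ψ t = stress g ψ' t := by
  funext a
  refine intervalIntegral.integral_congr fun τ hτ => ?_
  rw [uIcc_of_le ht] at hτ
  simp only [h τ hτ.1]

theorem auxField_congr {ψ ψ' : ℝ → GradIdx n → L2} (h : ∀ τ, 0 ≤ τ → ψ τ = ψ' τ) {t : ℝ}
    (ht : 0 ≤ t) (s : ℝ) : auxField ψ t s = auxField ψ' t s := by
  funext a
  refine intervalIntegral.integral_congr fun τ hτ => ?_
  rw [uIcc_of_le ht] at hτ
  simp only [h τ hτ.1]

theorem continuousOn_stress {g : ℝ → ℝ} (hg : LocallyIntegrableOn g (Ici 0))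
    {ψ : ℝ → GradIdx n → L2} (hψ : ContinuousOn ψ (Ici 0)) (a : GradIdx n) :
    ContinuousOn (fun t => stress g ψ t a) (Ici 0) := by
  have hc : Continuous fun τ => ψ (max 0 τ) a :=
    (continuous_apply a).comp hψ.continuous_comp_max
  refine (continuousOn_causal_convolution hg hc).congr fun t ht => ?_
  exact congrFun (stress_congr (ψ' := fun τ => ψ (max 0 τ))
    (fun τ hτ => by rw [max_eq_right hτ]) ht) a

theorem kineticEnergy_eq (ρ : ℝ) (v : Fin n → L2) :
    kineticEnergy ρ v = ρ / 2 * ∑ i, ‖v i‖ ^ 2 := by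
  have h : ∀ f : L2, ‖f‖ ^ 2 = ∫ x, ‖f x‖ ^ 2 := fun f => by
    have h1 : (inner ℂ f f).re = ‖f‖ ^ 2 := inner_self_eq_norm_sq (𝕜 := ℂ) f
    rw [← h1, L2.inner_def]
    have h2 := integral_re (𝕜 := ℂ) (L2.integrable_inner (𝕜 := ℂ) f f)
    refine Eq.trans h2.symm (integral_congr_ae (Eventually.of_forall fun x => ?_))
    exact inner_self_eq_norm_sq (𝕜 := ℂ) (f x)
  have hi : ∀ f : L2, Integrable fun x => ‖f x‖ ^ 2 := fun f =>
    (memLp_two_iff_integrable_sq_norm (Lp.aestronglyMeasurable f)).1 (Lp.memLp f)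
  simp only [h]
  rw [← integral_finsetSum _ fun i _ => hi (v i), ← integral_const_mul]
  refine integral_congr_ae (Eventually.of_forall fun x => ?_)
  simp only
  ring

namespace IsSolution

variable {ρ : ℝ} {g : ℝ → ℝ} {H : Space → Matrix (GradIdx n) (GradIdx n) ℝ}
  {u v : ℝ → Fin n → L2} {G : ℝ → GradIdx n → L2}

/-- The momentum equation integrated in time. -/
theorem momentum_integrated (hu : IsSolution ρ g H u v G) (hg : LocallyIntegrableOn g (Ici 0))
    {b : ℝ} (hb : 0 ≤ b) (i : Fin n) (φ : 𝓢(Space, ℂ)) :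
    (ρ : ℂ) * (v b i : 𝓢'(Space, ℂ)) φ - (ρ : ℂ) * (v 0 i : 𝓢'(Space, ℂ)) φ =
      ∑ j, pderiv j ((∫ τ in (0 : ℝ)..b, stress g (fun τ => symbolOp H (G τ)) τ (i, j) : L2) :
        𝓢'(Space, ℂ)) φ := by
  have hσ := fun j => continuousOn_stress hg hu.continuousOn_psi (i, j)
  have hσi : ∀ j, IntervalIntegrable (fun τ => stress g (fun τ => symbolOp H (G τ)) τ (i, j))
      volume 0 b := fun j =>
    ((hσ j).mono (by rw [uIcc_of_le hb]; exact Icc_subset_Ici_self)).intervalIntegrable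
  have hev : ∀ ψ : 𝓢(Space, ℂ), ∀ j, IntervalIntegrable (fun τ => evalSchwartz ψ
      (stress g (fun τ => symbolOp H (G τ)) τ (i, j))) volume 0 b := fun ψ j =>
    (((evalSchwartz ψ).continuous.comp_continuousOn (hσ j)).mono
      (by rw [uIcc_of_le hb]; exact Icc_subset_Ici_self)).intervalIntegrable
  -- The derivative is needed only on the open interval; continuity of `v` covers the endpoint 0,
  -- where the momentum equation is not assumed.
  have hftc := intervalIntegral.integral_eq_sub_of_hasDerivAt_of_le hb
    (f := fun τ => (ρ : ℂ) * (v τ i : 𝓢'(Space, ℂ)) φ) ?_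
    (fun t ht => hu.momentum t ht.1 i φ) ?_
  · rw [← hftc]
    simp only [pderiv_apply]
    rw [intervalIntegral.integral_finsetSum fun j _ => hev _ j]
    exact Finset.sum_congr rfl fun j _ =>
      ((evalSchwartz _).restrictScalars ℝ).intervalIntegral_comp_comm (hσi j)
  · refine continuousOn_const.mul ?_
    have hvi : ContinuousOn (fun τ => v τ i) (Icc 0 b) :=
      ((continuous_apply i).comp_continuousOn hu.continuousOn_velocity).mono Icc_subset_Ici_self
    exact (evalSchwartz φ).continuous.comp_continuousOn hvi
  · simp only [pderiv_apply]
    have := IntervalIntegrable.sum Finset.univ fun j _ =>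
      hev (-∂_{(EuclideanSpace.single j (1 : ℝ) : Space)} φ) j
    simpa only [Finset.sum_fn] using this

/-- The increment of the kinetic energy in terms of the time integral of the stress. -/
theorem kineticEnergy_sub (hu : IsSolution ρ g H u v G) (hg : LocallyIntegrableOn g (Ici 0))
    {a b : ℝ} (ha : 0 ≤ a) (hb : 0 ≤ b) :
    kineticEnergy ρ (v b) - kineticEnergy ρ (v a) =
      -(1 / 2) * ∑ c, (inner ℂ (G b c + G a c)
        ((∫ τ in (0 : ℝ)..b, stress g (fun τ => symbolOp H (G τ)) τ c) -
          ∫ τ in (0 : ℝ)..a, stress g (fun τ => symbolOp H (G τ)) τ c)).re := by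
  set S : ℝ → GradIdx n → L2 := fun b c =>
    ∫ τ in (0 : ℝ)..b, stress g (fun τ => symbolOp H (G τ)) τ c with hS
  have key : ∀ i, ρ * (‖v b i‖ ^ 2 - ‖v a i‖ ^ 2) =
      -∑ j, (inner ℂ (G b (i, j) + G a (i, j)) (S b (i, j) - S a (i, j))).re := by
    intro i
    -- The real part of `⟨v(b) + v(a), v(b) - v(a)⟩` is `‖v(b)‖² - ‖v(a)‖²`. The sum has an `L²`
    -- gradient, and `ρ` times the difference is the divergence of an `L²` field.
    have h := inner_eq_neg_sum_inner (w := v b i + v a i) (f := (ρ : ℂ) • (v b i - v a i))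
      (P := fun j => G b (i, j) + G a (i, j)) (F := fun j => S b (i, j) - S a (i, j)) ?_ ?_
    · have h2 := congrArg Complex.re h
      rw [inner_smul_right, Complex.re_ofReal_mul, Complex.neg_re, Complex.re_sum] at h2
      rw [← h2, inner_add_left, inner_sub_right, inner_sub_right]
      have e1 : (inner ℂ (v b i) (v b i)).re = ‖v b i‖ ^ 2 := inner_self_eq_norm_sq (𝕜 := ℂ) _
      have e2 : (inner ℂ (v a i) (v a i)).re = ‖v a i‖ ^ 2 := inner_self_eq_norm_sq (𝕜 := ℂ) _
      have e3 : (inner ℂ (v b i) (v a i)).re = (inner ℂ (v a i) (v b i)).re :=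
        inner_re_symm (𝕜 := ℂ) _ _
      simp only [Complex.add_re, Complex.sub_re, e1, e2, e3]
      ring
    · intro j φ
      have h1 := hu.gradient b hb i j
      have h2 := hu.gradient a ha i j
      rw [pderiv_apply, map_add, ← pderiv_apply, ← pderiv_apply, ← h1, ← h2, ← evalSchwartz_apply,
        map_add]
      rfl
    · intro φ
      have h1 := hu.momentum_integrated hg hb i φ
      have h2 := hu.momentum_integrated hg ha i φ
      rw [← evalSchwartz_apply, map_smul, map_sub, smul_eq_mul, mul_sub]
      simp only [pderiv_apply, map_sub, Finset.sum_sub_distrib] at h1 h2 ⊢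
      rw [← h1, ← h2]
      simp only [evalSchwartz_apply]
      ring
  rw [kineticEnergy_eq, kineticEnergy_eq, ← mul_sub, ← Finset.sum_sub_distrib, Fintype.sum_prod_type,
    Finset.mul_sum, Finset.mul_sum]
  refine Finset.sum_congr rfl fun i _ => ?_
  linear_combination (1 / 2) * key i

/-- The power balance of the kinetic energy. -/
theorem hasDerivWithinAt_kineticEnergy (hu : IsSolution ρ g H u v G)
    (hg : LocallyIntegrableOn g (Ici 0)) {t : ℝ} (ht : 0 ≤ t) :
    HasDerivWithinAt (fun τ => kineticEnergy ρ (v τ))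
      (-(∑ c, inner ℂ (stress g (fun τ => symbolOp H (G τ)) t c) (G t c)).re) (Ici 0) t := by
  rw [hasDerivWithinAt_iff_tendsto_slope]
  have hS : ∀ c, Tendsto (slope (fun b => ∫ τ in (0 : ℝ)..b,
      stress g (fun τ => symbolOp H (G τ)) τ c) t) (𝓝[Ici 0 \ {t}] t)
      (𝓝 (stress g (fun τ => symbolOp H (G τ)) t c)) := fun c =>
    hasDerivWithinAt_iff_tendsto_slope.1
      (hasDerivWithinAt_integral_Ici (continuousOn_stress hg hu.continuousOn_psi c) ht)
  have hG : ∀ c, Tendsto (fun b => G b c + G t c) (𝓝[Ici 0 \ {t}] t) (𝓝 (G t c + G t c)) :=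
    fun c => ((((continuous_apply c).comp_continuousOn hu.continuousOn_gradient) t ht).mono
      sdiff_subset).add_const _
  -- `G(b) + G(t)` tends to `2 G(t)`, which absorbs the factor 1/2, and the slope of the integrated
  -- stress tends to the stress.
  have hlim : Tendsto (fun b => -(1 / 2) * ∑ c, (inner ℂ (G b c + G t c)
      (slope (fun b => ∫ τ in (0 : ℝ)..b, stress g (fun τ => symbolOp H (G τ)) τ c) t b)).re)
      (𝓝[Ici 0 \ {t}] t) (𝓝 (-(1 / 2) * ∑ c, (inner ℂ (G t c + G t c)
        (stress g (fun τ => symbolOp H (G τ)) t c)).re)) :=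
    (tendsto_finsetSum _ fun c _ =>
      (Complex.continuous_re.tendsto _).comp ((hG c).inner (hS c))).const_mul _
  have hval : -(1 / 2) * ∑ c, (inner ℂ (G t c + G t c)
        (stress g (fun τ => symbolOp H (G τ)) t c)).re =
      -(∑ c, inner ℂ (stress g (fun τ => symbolOp H (G τ)) t c) (G t c)).re := by
    rw [Complex.re_sum, Finset.mul_sum, ← Finset.sum_neg_distrib]
    refine Finset.sum_congr rfl fun c _ => ?_
    have : (inner ℂ (G t c) (stress g (fun τ => symbolOp H (G τ)) t c)).re =
        (inner ℂ (stress g (fun τ => symbolOp H (G τ)) t c) (G t c)).re := inner_re_symm (𝕜 := ℂ) _ _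
    rw [inner_add_left, Complex.add_re, this]
    ring
  rw [← hval]
  refine hlim.congr' ?_
  filter_upwards [self_mem_nhdsWithin] with b hb
  rw [slope_def_field, hu.kineticEnergy_sub hg ht hb.1, mul_div_assoc, Finset.sum_div]
  refine congrArg _ (Finset.sum_congr rfl fun c _ => ?_)
  rw [slope_def_module, inner_smul_right_eq_smul, Complex.smul_re, smul_eq_mul]
  ring

end IsSolution

/-! ### The stored energy as accumulated stress power. -/

/-- The pairing `∫ ψ(a)† G(τ) dx` of two curves of fields. -/
def energyKernel (ψ G : ℝ → GradIdx n → L2) (a τ : ℝ) : ℂ := ∑ c, inner ℂ (ψ a c) (G τ c)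

theorem continuous_energyKernel {ψ G : ℝ → GradIdx n → L2} (hψ : Continuous ψ) (hG : Continuous G) :
    Continuous (Function.uncurry (energyKernel ψ G)) := by
  refine continuous_finsetSum _ fun c _ => Continuous.inner ?_ ?_
  · exact (continuous_apply c).comp (hψ.comp continuous_fst)
  · exact (continuous_apply c).comp (hG.comp continuous_snd)

theorem intervalIntegrable_exp_smul {f : ℝ → GradIdx n → L2} (hf : Continuous f) (t s : ℝ)
    (c : GradIdx n) : IntervalIntegrable
      (fun τ : ℝ => Complex.exp (Complex.I * s * (t - τ)) • f τ c) volume 0 t := by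
  have : Continuous fun τ => f τ c := (continuous_apply c).comp hf
  exact (by fun_prop : Continuous fun τ : ℝ =>
    Complex.exp (Complex.I * s * (t - τ)) • f τ c).intervalIntegrable _ _

/-- The pairing of auxiliary fields as a double time integral. -/
theorem sum_inner_auxField {ψ G : ℝ → GradIdx n → L2} (hψ : Continuous ψ) (hG : Continuous G)
    (t s : ℝ) :
    ∑ c, inner ℂ (auxField ψ t s c) (auxField G t s c) =
      ∫ τ in (0 : ℝ)..t, ∫ a in (0 : ℝ)..t,
        Complex.exp (Complex.I * s * (a - τ)) * energyKernel ψ G a τ := by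
  have hψc : ∀ c, Continuous fun τ => ψ τ c := fun c => (continuous_apply c).comp hψ
  have hGc : ∀ c, Continuous fun τ => G τ c := fun c => (continuous_apply c).comp hG
  -- Conjugation cancels the common phase `e^{ist}`.
  have hexp : ∀ a τ : ℝ, (starRingEnd ℂ) (Complex.exp (Complex.I * s * (t - a))) *
      Complex.exp (Complex.I * s * (t - τ)) = Complex.exp (Complex.I * s * (a - τ)) := fun a τ => by
    rw [← Complex.exp_conj, ← Complex.exp_add]
    congr 1
    simp only [map_mul, map_sub, Complex.conj_I, Complex.conj_ofReal]
    ring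
  have h1 : ∀ c, inner ℂ (auxField ψ t s c) (auxField G t s c) =
      ∫ τ in (0 : ℝ)..t, Complex.exp (Complex.I * s * (t - τ)) *
        inner ℂ (auxField ψ t s c) (G τ c) := fun c => by
    conv_lhs => rw [auxField.eq_def G]
    rw [inner_intervalIntegral (intervalIntegrable_exp_smul hG t s c)]
    simp only [inner_smul_right]
  have h2 : ∀ (c : GradIdx n) (τ : ℝ), Complex.exp (Complex.I * s * (t - τ)) * inner ℂ (auxField ψ t s c) (G τ c) =
      ∫ a in (0 : ℝ)..t, Complex.exp (Complex.I * s * (a - τ)) * inner ℂ (ψ a c) (G τ c) :=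
    fun c τ => by
      rw [auxField, intervalIntegral_inner (intervalIntegrable_exp_smul hψ t s c),
        ← intervalIntegral.integral_const_mul]
      refine intervalIntegral.integral_congr fun a _ => ?_
      simp only [inner_smul_left, ← hexp a τ]
      ring
  simp only [h1, energyKernel, Finset.mul_sum]
  rw [← intervalIntegral.integral_finsetSum]
  · refine intervalIntegral.integral_congr fun τ _ => ?_
    simp only [h2]
    rw [← intervalIntegral.integral_finsetSum]
    intro c _
    have := hψc c
    exact (by fun_prop : Continuous fun a : ℝ =>
      Complex.exp (Complex.I * s * (a - τ)) * inner ℂ (ψ a c) (G τ c)).intervalIntegrable _ _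
  · intro c _
    have := hGc c
    exact (by fun_prop : Continuous fun τ : ℝ => Complex.exp (Complex.I * s * (t - τ)) *
        inner ℂ (auxField ψ t s c) (G τ c)).intervalIntegrable _ _

theorem integral_energyKernel_eq_sum_inner_stress {g : ℝ → ℝ} (hg : LocallyIntegrableOn g (Ici 0))
    {ψ G : ℝ → GradIdx n → L2} (hψ : Continuous ψ) {τ : ℝ} (hτ : 0 ≤ τ) :
    ∫ a in (0 : ℝ)..τ, (g (τ - a) : ℂ) * energyKernel ψ G a τ =
      ∑ c, inner ℂ (stress g ψ τ c) (G τ c) := by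
  have hgi : IntervalIntegrable g volume 0 τ := by
    rw [intervalIntegrable_iff_integrableOn_Icc_of_le hτ]
    exact hg.integrableOn_compact_subset Icc_subset_Ici_self isCompact_Icc
  have hgr : IntervalIntegrable (fun a => (g (τ - a) : ℂ)) volume 0 τ := by
    have h := (hgi.comp_sub_left τ).symm
    simp only [sub_zero, sub_self] at h
    exact ⟨h.1.ofReal, h.2.ofReal⟩
  have hψc : ∀ c, Continuous fun τ => ψ τ c := fun c => (continuous_apply c).comp hψ
  simp only [energyKernel, Finset.mul_sum, stress]
  rw [intervalIntegral.integral_finsetSum]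
  · refine Finset.sum_congr rfl fun c _ => ?_
    rw [intervalIntegral_inner (hgr.smul_continuousOn (hψc c).continuousOn)]
    simp only [inner_smul_left, Complex.conj_ofReal]
  · intro c _
    have := hψc c
    exact hgr.mul_continuousOn (by fun_prop)

section Energy

variable {H : Space → Matrix (GradIdx n) (GradIdx n) ℝ} {ψ G : ℝ → GradIdx n → L2}

theorem auxField_mem_symbolGraph (hψ : Continuous ψ) (hG : Continuous G)
    (hgraph : ∀ τ, (G τ, ψ τ) ∈ symbolGraph H) {t : ℝ} (ht : 0 ≤ t) (s : ℝ) :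
    (auxField G t s, auxField ψ t s) ∈ symbolGraph H :=
  intervalIntegral_smul_mem_symbolGraph hG hψ hgraph
    (by fun_prop : Continuous fun τ : ℝ => Complex.exp (Complex.I * s * (t - τ))) ht

/-- The preimage of `y_ψ` under `H` is known in advance to be the `L²` field `y_G`, so the domain
condition needs no lower bound on the eigenvalues of `Ĥ`. -/
theorem auxField_mem_symbolGraph_inv (hH : ∀ k, k ≠ 0 → (H k).PosDef) (hψ : Continuous ψ)
    (hG : Continuous G) (hgraph : ∀ τ, (G τ, ψ τ) ∈ symbolGraph H) {t : ℝ} (ht : 0 ≤ t) (s : ℝ) :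
    (auxField ψ t s, auxField G t s) ∈ symbolGraph fun k => (H k)⁻¹ :=
  mem_symbolGraph_inv (fun k hk => (hH k hk).det_pos.ne'.isUnit)
    (auxField_mem_symbolGraph hψ hG hgraph ht s)

theorem storedDensity_eq_sum_inner (hH : ∀ k, k ≠ 0 → (H k).PosDef) (hψ : Continuous ψ)
    (hG : Continuous G) (hgraph : ∀ τ, (G τ, ψ τ) ∈ symbolGraph H) {t : ℝ} (ht : 0 ≤ t) (s : ℝ) :
    storedDensity H ψ t s = ∑ c, inner ℂ (auxField ψ t s c) (auxField G t s c) := by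
  rw [storedDensity, symbolOp_eq_of_mem_symbolGraph
    (auxField_mem_symbolGraph_inv hH hψ hG hgraph ht s)]
  simp only [L2.inner_def]
  rw [← integral_finsetSum _ fun c _ => L2.integrable_inner _ _]
  refine integral_congr_ae (Eventually.of_forall fun x => Finset.sum_congr rfl fun c _ => ?_)
  rw [RCLike.inner_apply, mul_comm]

/-- The density is `⟨H y_G, y_G⟩`. Its sign yields `U ≥ 0` and is also what the extended spectral
identity requires. -/
theorem storedDensity_nonneg (hH : ∀ k, k ≠ 0 → (H k).IsSymm ∧ (H k).PosDef) (hψ : Continuous ψ)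
    (hG : Continuous G) (hgraph : ∀ τ, (G τ, ψ τ) ∈ symbolGraph H) {t : ℝ} (ht : 0 ≤ t) (s : ℝ) :
    0 ≤ (storedDensity H ψ t s).re ∧ (storedDensity H ψ t s).im = 0 := by
  have hmem := auxField_mem_symbolGraph hψ hG hgraph ht s
  rw [storedDensity_eq_sum_inner (fun k hk => (hH k hk).2) hψ hG hgraph ht]
  refine ⟨sum_inner_nonneg_of_mem_symbolGraph (fun k hk => (hH k hk).2.posSemidef) hmem, ?_⟩
  rw [← Complex.conj_eq_iff_im, map_sum]
  simp only [inner_conj_symm]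
  exact (sum_inner_symm_of_mem_symbolGraph (fun k hk => (hH k hk).1) hmem hmem).symm

/-- The stored energy is the time integral of the stress power. -/
theorem integrable_storedDensity_and_storedEnergy_eq {g : ℝ → ℝ}
    (hg : LocallyIntegrableOn g (Ici 0)) {m : Measure ℝ} (hm : IsSpectralMeasure g m)
    (hH : ∀ k, k ≠ 0 → (H k).IsSymm ∧ (H k).PosDef) (hψ : Continuous ψ)
    (hG : Continuous G) (hgraph : ∀ τ, (G τ, ψ τ) ∈ symbolGraph H) {t : ℝ} (ht : 0 ≤ t) :
    Integrable (fun s => storedDensity H ψ t s) m ∧ storedEnergy m H ψ t =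
      (((∫ τ in (0 : ℝ)..t, ∑ c, inner ℂ (stress g ψ τ c) (G τ c)).re : ℝ) : ℂ) := by
  have hnn := storedDensity_nonneg hH hψ hG hgraph ht
  have key := hm.integrable_and_integral_energy hg (continuous_energyKernel hψ hG)
    -- The kernel is Hermitian because `H` is symmetric: `⟨H G(τ), G(a)⟩ = ⟨G(τ), H G(a)⟩`.
    (fun a τ => by
      simp only [energyKernel, map_sum, inner_conj_symm]
      exact sum_inner_symm_of_mem_symbolGraph (fun k hk => (hH k hk).1) (hgraph τ) (hgraph a))
    ht (Q := storedDensity H ψ t)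
    (fun s => by
      rw [storedDensity_eq_sum_inner (fun k hk => (hH k hk).2) hψ hG hgraph ht,
        sum_inner_auxField hψ hG])
    (fun s => (hnn s).1) (fun s => (hnn s).2)
  refine ⟨key.1, ?_⟩
  rw [storedEnergy, key.2]
  have : ∫ τ in (0 : ℝ)..t, ∫ a in (0 : ℝ)..τ, (g (τ - a) : ℂ) * energyKernel ψ G a τ =
      ∫ τ in (0 : ℝ)..t, ∑ c, inner ℂ (stress g ψ τ c) (G τ c) := by
    refine intervalIntegral.integral_congr fun τ hτ => ?_
    rw [uIcc_of_le ht] at hτ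
    exact integral_energyKernel_eq_sum_inner_stress hg hψ hτ.1
  rw [this]
  push_cast
  ring

end Energy

end NonlocalVisco

end

/-! ### Conservation and positivity of the energy. -/

theorem mainTheorem7 (n : ℕ) (ρ : ℝ) (hρ : 0 < ρ)
    (g : ℝ → ℝ) (hg : NonlocalVisco.IsCausallyPositiveDefinite g)
    (m : MeasureTheory.Measure ℝ) (hm : NonlocalVisco.IsSpectralMeasure g m)
    (H : NonlocalVisco.Space →
      Matrix (NonlocalVisco.GradIdx n) (NonlocalVisco.GradIdx n) ℝ)
    (hH_meas : ∀ a b, Measurable fun k => H k a b)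
    (hH : ∀ k, k ≠ 0 → (H k).IsSymm ∧ (H k).PosDef)
    (u v : ℝ → Fin n → NonlocalVisco.L2)
    (G ψ : ℝ → NonlocalVisco.GradIdx n → NonlocalVisco.L2)
    (hu : NonlocalVisco.IsSolution ρ g H u v G)
    (hψ : ∀ t, ψ t = NonlocalVisco.symbolOp H (G t)) :
    (∀ t, 0 ≤ t →
      (∀ s, NonlocalVisco.InDomain (fun k => (H k)⁻¹) (NonlocalVisco.auxField ψ t s)) ∧
      MeasureTheory.Integrable (fun s => NonlocalVisco.storedDensity H ψ t s) m) ∧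
    (∀ t, 0 ≤ t →
      HasDerivWithinAt
        (fun τ => (NonlocalVisco.kineticEnergy ρ (v τ) : ℂ) +
          NonlocalVisco.storedEnergy m H ψ τ) 0 (Set.Ici 0) t) ∧
    (∀ t, 0 ≤ t →
      0 ≤ (NonlocalVisco.storedEnergy m H ψ t).re ∧
      (NonlocalVisco.storedEnergy m H ψ t).im = 0) := by
  open NonlocalVisco in
  obtain rfl : ψ = fun t => symbolOp H (G t) := funext hψ
  set ψ : ℝ → GradIdx n → L2 := fun t => symbolOp H (G t)
  -- The solution is constrained only for `τ ≥ 0`, while the stored-energy lemmas take curves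
  -- continuous on `ℝ`; the frozen extensions bridge this.
  let G' : ℝ → GradIdx n → L2 := fun τ => G (max 0 τ)
  let ψ' : ℝ → GradIdx n → L2 := fun τ => ψ (max 0 τ)
  have hG'c : Continuous G' := hu.continuousOn_gradient.continuous_comp_max
  have hψ'c : Continuous ψ' := hu.continuousOn_psi.continuous_comp_max
  have hG' : ∀ τ, 0 ≤ τ → G' τ = G τ := fun τ hτ => by simp only [G', max_eq_right hτ]
  have hψ' : ∀ τ, 0 ≤ τ → ψ τ = ψ' τ := fun τ hτ => by simp only [ψ', max_eq_right hτ]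
  have hgraph : ∀ τ, (G' τ, ψ' τ) ∈ symbolGraph H := fun τ =>
    (hu.domain _ (le_max_left 0 τ)).mem_symbolGraph
  have haux : ∀ t, 0 ≤ t → ∀ s, auxField ψ t s = auxField ψ' t s := fun t ht s =>
    auxField_congr hψ' ht s
  have hdens : ∀ t, 0 ≤ t → storedDensity H ψ t = storedDensity H ψ' t := fun t ht => by
    funext s
    simp only [storedDensity, haux t ht s]
  have henergy : ∀ t, 0 ≤ t → storedEnergy m H ψ t = storedEnergy m H ψ' t := fun t ht => by
    simp only [storedEnergy, hdens t ht]
  have hmain := fun t (ht : 0 ≤ t) =>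
    integrable_storedDensity_and_storedEnergy_eq hg.1 hm hH hψ'c hG'c hgraph ht
  have hpower : ∀ t, 0 ≤ t → storedEnergy m H ψ t =
      (((∫ τ in (0 : ℝ)..t, ∑ c, inner ℂ (stress g ψ τ c) (G τ c)).re : ℝ) : ℂ) := fun t ht => by
    rw [henergy t ht, (hmain t ht).2]
    congr 2
    refine intervalIntegral.integral_congr fun τ hτ => ?_
    rw [Set.uIcc_of_le ht] at hτ
    simp only [hG' τ hτ.1, stress_congr hψ' hτ.1]
  refine ⟨fun t ht => ⟨fun s => ?_, ?_⟩, fun t ht => ?_, fun t ht => ?_⟩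
  · rw [haux t ht]
    exact inDomain_of_mem_symbolGraph
      (auxField_mem_symbolGraph_inv (fun k hk => (hH k hk).2) hψ'c hG'c hgraph ht s)
  · rw [hdens t ht]
    exact (hmain t ht).1
  · have hkin := (hu.hasDerivWithinAt_kineticEnergy hg.1 ht).ofReal_comp
    have hcont : ContinuousOn (fun τ => ∑ c, inner ℂ (stress g ψ τ c) (G τ c)) (Set.Ici 0) :=
      continuousOn_finsetSum _ fun c _ => (continuousOn_stress hg.1 hu.continuousOn_psi c).inner
        ((continuous_apply c).comp_continuousOn hu.continuousOn_gradient)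
    have hint := hasDerivWithinAt_integral_Ici hcont ht
    have hre := (Complex.reCLM.hasFDerivAt.comp_hasDerivWithinAt t hint).ofReal_comp
    have hsum := hkin.add hre
    -- The power lost by the kinetic energy is the power gained by `U`.
    have hzero : (((-(∑ c, inner ℂ (stress g ψ t c) (G t c)).re : ℝ) : ℂ) +
        ((Complex.reCLM (∑ c, inner ℂ (stress g ψ t c) (G t c)) : ℝ) : ℂ)) = 0 := by
      rw [Complex.reCLM_apply]
      push_cast
      ring
    rw [hzero] at hsum
    refine hsum.congr (fun τ hτ => ?_) ?_
    · simp only [hpower τ hτ]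
      rfl
    · simp only [hpower t ht]
      rfl
  · have hnn := storedDensity_nonneg hH hψ'c hG'c hgraph ht
    have hre : ∀ s, storedDensity H ψ' t s = ((storedDensity H ψ' t s).re : ℂ) := fun s =>
      Complex.ext (by simp) (by simp [(hnn s).2])
    have h : storedEnergy m H ψ t =
        ((1 / 2 * ∫ s, (storedDensity H ψ' t s).re ∂m : ℝ) : ℂ) := by
      have hint : ∫ s, storedDensity H ψ' t s ∂m =
          ((∫ s, (storedDensity H ψ' t s).re ∂m : ℝ) : ℂ) :=
        (MeasureTheory.integral_congr_ae (Filter.Eventually.of_forall hre)).trans integral_ofReal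
      rw [henergy t ht, storedEnergy, hint]
      push_cast
      rfl
    rw [h]
    refine ⟨?_, Complex.ofReal_im _⟩
    rw [Complex.ofReal_re]
    exact mul_nonneg (by norm_num) (MeasureTheory.integral_nonneg fun s => (hnn s).1)
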